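/- Let $n$ be a non-negative integer and let $\mathbb{D}^n$ be the unit polydisc of $\mathbb{C}^n$. For $1\le p<\infty$ let $H^p(\mathbb{D}^n)$ be the space of holomorphic functions $f$ on $\mathbb{D}^n$ with $$\|f\|_{H^p}:=\sup_{0\le r<1}\Big(\int_{\mathbb{T}^n}|f(re^{i\theta_1},\dots,re^{i\theta_n})|^p\,d\theta\Big)^{1/p}<\infty,$$ where $d\theta$ is the normalized Lebesgue measure on the torus $\mathbb{T}^n$. For $0<\theta<1$ let $(H^2(\mathbb{D}^n),H^4(\mathbb{D}^n))_\theta$ be the complex interpolation space: the set of all values $F(\theta)$, where $F$ runs over the bounded continuous functions from the strip $0\le \operatorname{Re} z\le 1$ to $H^2(\mathbb{D}^n)+H^4(\mathbb{D}^n)$ that are holomorphic in $0<\operatorname{Re} z<1$ and for which $t\mapsto F(it)$ is a bounded continuous function $\mathbb{R}\to H^2(\mathbb{D}^n)$ and $t\mapsto F(1+it)$ a bounded continuous function $\mathbb{R}\to H^4(\mathbb{D}^n)$; its norm is $$\|f\|_\theta:=\inf_{F(\theta)=f}\ \max\Big(\sup_{t\in\mathbb{R}}\|F(it)\|_{H^2},\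 \sup_{t\in\mathbb{R}}\|F(1+it)\|_{H^4}\Big).$$ Then there is a constant $C$, depending only on $n$, such that for every $\theta\in(0,1)$, with $p$ defined by $\frac1p=\frac{1-\theta}{2}+\frac{\theta}{4}$, $$(H^2(\mathbb{D}^n),H^4(\mathbb{D}^n))_\theta=H^p(\mathbb{D}^n),$$ with equivalent norms: $\|f\|_\theta\le C\,\|f\|_{H^p}$ and $\|f\|_{H^p}\le C\,\|f\|_\theta$ for all $f\in H^p(\mathbb{D}^n)$. -/

import Mathlib

open MeasureTheory Set
open scoped ENNReal NNReal BoundedContinuousFunction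

noncomputable section

/-! ### The polydisc and its Hardy spaces -/

/-- The open unit polydisc of `ℂⁿ`. -/
def openPolydisc (n : ℕ) : Set (Fin n → ℂ) := {z | ∀ j, ‖z j‖ < 1}

/-- `f` is holomorphic on the polydisc: it is the restriction of a function on `ℂⁿ` that is
complex differentiable on the polydisc. -/
def IsHolomorphicOnPolydisc {n : ℕ} (f : openPolydisc n → ℂ) : Prop :=
  ∃ g : (Fin n → ℂ) → ℂ, DifferentiableOn ℂ g (openPolydisc n) ∧ ∀ z : openPolydisc n, f z = g z

/-- Normalized Lebesgue (Haar probability) measure on the torus `(ℝ/ℤ)ⁿ`. -/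
def torusMeasure (n : ℕ) : Measure (UnitAddTorus (Fin n)) :=
  Measure.pi fun _ => AddCircle.haarAddCircle

/-- The point `(r e^{2πi t₁}, …, r e^{2πi tₙ})` of the polydisc. -/
def dilatedTorusPoint {n : ℕ} (r : Ico (0 : ℝ) 1) (t : UnitAddTorus (Fin n)) : openPolydisc n :=
  ⟨fun j => (r : ℂ) * (AddCircle.toCircle (t j) : ℂ), fun j => by
    have h0 := r.2.1
    have h1 := r.2.2
    rw [norm_mul, Circle.norm_coe, mul_one, Complex.norm_of_nonneg h0]
    exact h1⟩

/-- The Hardy norm `sup_{0 ≤ r < 1} (∫_{𝕋ⁿ} |f(r e^{iθ})|^p dθ)^{1/p}`, possibly infinite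
(and the supremum norm over the polydisc for `p = ∞`). -/
def hardyNorm {n : ℕ} (p : ℝ≥0∞) (f : openPolydisc n → ℂ) : ℝ≥0∞ :=
  ⨆ r : Ico (0 : ℝ) 1, eLpNorm (fun t => f (dilatedTorusPoint r t)) p (torusMeasure n)

theorem continuous_dilatedTorusPoint {n : ℕ} (r : Ico (0 : ℝ) 1) :
    Continuous (dilatedTorusPoint (n := n) r) := by
  refine Continuous.subtype_mk (continuous_pi fun j => continuous_const.mul ?_) _
  exact continuous_subtype_val.comp (AddCircle.continuous_toCircle.comp (continuous_apply j))

theorem IsHolomorphicOnPolydisc.continuous {n : ℕ} {f : openPolydisc n → ℂ}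
    (hf : IsHolomorphicOnPolydisc f) : Continuous f := by
  obtain ⟨g, hg, hfg⟩ := hf
  have h := continuousOn_iff_continuous_domRestrict.1 hg.continuousOn
  have : f = (openPolydisc n).domRestrict g := funext hfg
  rw [this]
  exact h

theorem IsHolomorphicOnPolydisc.continuous_dilate {n : ℕ} {f : openPolydisc n → ℂ}
    (hf : IsHolomorphicOnPolydisc f) (r : Ico (0 : ℝ) 1) :
    Continuous fun t => f (dilatedTorusPoint r t) :=
  hf.continuous.comp (continuous_dilatedTorusPoint r)

theorem IsHolomorphicOnPolydisc.aestronglyMeasurable {n : ℕ} {f : openPolydisc n → ℂ}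
    (hf : IsHolomorphicOnPolydisc f) (r : Ico (0 : ℝ) 1) :
    AEStronglyMeasurable (fun t => f (dilatedTorusPoint r t)) (torusMeasure n) :=
  (hf.continuous_dilate r).aestronglyMeasurable

theorem IsHolomorphicOnPolydisc.add {n : ℕ} {f g : openPolydisc n → ℂ}
    (hf : IsHolomorphicOnPolydisc f) (hg : IsHolomorphicOnPolydisc g) :
    IsHolomorphicOnPolydisc (f + g) := by
  obtain ⟨F, hF, hfF⟩ := hf
  obtain ⟨G, hG, hgG⟩ := hg
  exact ⟨F + G, hF.add hG, fun z => by simp [hfF, hgG]⟩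

theorem IsHolomorphicOnPolydisc.smul {n : ℕ} {f : openPolydisc n → ℂ}
    (hf : IsHolomorphicOnPolydisc f) (c : ℂ) : IsHolomorphicOnPolydisc (c • f) := by
  obtain ⟨F, hF, hfF⟩ := hf
  exact ⟨c • F, hF.const_smul c, fun z => by simp [hfF]⟩

theorem hardyNorm_zero {n : ℕ} (p : ℝ≥0∞) : hardyNorm p (0 : openPolydisc n → ℂ) = 0 := by
  simp [hardyNorm]

theorem hardyNorm_smul {n : ℕ} (p : ℝ≥0∞) (c : ℂ) (f : openPolydisc n → ℂ) :
    hardyNorm p (c • f) = ‖c‖ₑ * hardyNorm p f := by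
  simp only [hardyNorm, ENNReal.mul_iSup]
  exact iSup_congr fun r => eLpNorm_const_smul c (fun t => f (dilatedTorusPoint r t)) p _

theorem hardyNorm_add_le' {n : ℕ} (p : ℝ≥0∞) {f g : openPolydisc n → ℂ}
    (hf : IsHolomorphicOnPolydisc f) (hg : IsHolomorphicOnPolydisc g) :
    hardyNorm p (f + g) ≤ ENNReal.LpAddConst p * (hardyNorm p f + hardyNorm p g) := by
  refine iSup_le fun r => ?_
  refine (eLpNorm_add_le' (hf.aestronglyMeasurable r) (hg.aestronglyMeasurable r) p).trans ?_
  refine mul_le_mul_right (add_le_add ?_ ?_) _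
  · exact le_iSup (fun r : Ico (0 : ℝ) 1 =>
      eLpNorm (fun t => f (dilatedTorusPoint r t)) p (torusMeasure n)) r
  · exact le_iSup (fun r : Ico (0 : ℝ) 1 =>
      eLpNorm (fun t => g (dilatedTorusPoint r t)) p (torusMeasure n)) r

theorem hardyNorm_add_le {n : ℕ} {p : ℝ≥0∞} (hp : 1 ≤ p) {f g : openPolydisc n → ℂ}
    (hf : IsHolomorphicOnPolydisc f) (hg : IsHolomorphicOnPolydisc g) :
    hardyNorm p (f + g) ≤ hardyNorm p f + hardyNorm p g := by
  have h := hardyNorm_add_le' p hf hg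
  rwa [ENNReal.LpAddConst_of_one_le hp, one_mul] at h

/-- The Hardy space `H^p(𝔻ⁿ)`: the holomorphic functions on the polydisc of finite Hardy norm. -/
def hardySpace (n : ℕ) (p : ℝ≥0∞) : Submodule ℂ (openPolydisc n → ℂ) where
  carrier := {f | IsHolomorphicOnPolydisc f ∧ hardyNorm p f < ∞}
  zero_mem' := ⟨⟨0, differentiableOn_const 0, fun _ => rfl⟩, by simp [hardyNorm_zero]⟩
  add_mem' := fun {f g} hf hg => ⟨hf.1.add hg.1, (hardyNorm_add_le' p hf.1 hg.1).trans_lt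
    (ENNReal.mul_lt_top (ENNReal.LpAddConst_lt_top p) (ENNReal.add_lt_top.2 ⟨hf.2, hg.2⟩))⟩
  smul_mem' := fun c f hf => ⟨hf.1.smul c, by
    rw [hardyNorm_smul]
    exact ENNReal.mul_lt_top enorm_lt_top hf.2⟩

theorem IsHolomorphicOnPolydisc.eq_zero_of_hardyNorm_eq_zero {n : ℕ} {p : ℝ≥0∞} (hp : p ≠ 0)
    {f : openPolydisc n → ℂ} (hf : IsHolomorphicOnPolydisc f) (h0 : hardyNorm p f = 0) :
    f = 0 := by
  let r : Ico (0 : ℝ) 1 := ⟨1 / 2, by norm_num, by norm_num⟩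
  have hr : ‖((r : ℝ) : ℂ)‖ = 1 / 2 := by simp [r]
  have h1 : eLpNorm (fun t => f (dilatedTorusPoint r t)) p (torusMeasure n) = 0 :=
    le_antisymm ((le_iSup (fun r : Ico (0 : ℝ) 1 =>
      eLpNorm (fun t => f (dilatedTorusPoint r t)) p (torusMeasure n)) r).trans h0.le) bot_le
  rw [eLpNorm_eq_zero_iff (hf.aestronglyMeasurable r) hp] at h1
  have : (torusMeasure n).IsOpenPosMeasure := by unfold torusMeasure; infer_instance
  have h2 := (Continuous.ae_eq_iff_eq (torusMeasure n) (hf.continuous_dilate r)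
    continuous_const).1 h1
  obtain ⟨g, hg, hfg⟩ := hf
  have key : ∀ s : Finset (Fin n), ∀ z : Fin n → ℂ, (∀ j ∈ s, ‖z j‖ < 1) →
      (∀ j ∉ s, ‖z j‖ = 1 / 2) → g z = 0 := by
    intro s
    induction s using Finset.induction_on with
    | empty =>
      intro z _ hz
      have hz' : ∀ j, ∃ t : UnitAddCircle, (AddCircle.toCircle t : ℂ) = 2 * z j := by
        intro j
        have hj := hz j (by simp)
        obtain ⟨t, ht⟩ := (AddCircle.homeomorphCircle (T := (1 : ℝ)) one_ne_zero).surjective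
          ⟨2 * z j, by simp [Submonoid.unitSphere, hj]⟩
        refine ⟨t, ?_⟩
        rw [AddCircle.homeomorphCircle_apply] at ht
        rw [ht]
      choose t ht using hz'
      have h3 := congrFun h2 t
      have h4 : ((dilatedTorusPoint r t : openPolydisc n) : Fin n → ℂ) = z := by
        funext j
        simp [dilatedTorusPoint, ht, r]
      simp only [hfg, h4] at h3
      exact h3
    | insert i s hi ih =>
      intro z hz hz'
      have hz1 : ∀ j, j ≠ i → ‖z j‖ < 1 := by
        intro j hj
        by_cases hjs : j ∈ s
        · exact hz j (Finset.mem_insert_of_mem hjs)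
        · rw [hz' j (by simp [hj, hjs])]; norm_num
      have hmaps : MapsTo (fun w : ℂ => Function.update z i w) (Metric.ball 0 1)
          (openPolydisc n) := by
        intro w hw j
        by_cases hj : j = i
        · subst hj; simpa using hw
        · simpa [hj] using hz1 j hj
      have hd : DifferentiableOn ℂ (fun w : ℂ => g (Function.update z i w)) (Metric.ball 0 1) :=
        hg.comp (fun w _ => (hasFDerivAt_update z w).differentiableAt.differentiableWithinAt)
          hmaps
      have ha := hd.analyticOnNhd Metric.isOpen_ball
      have hS : ∀ w : ℂ, ‖w‖ = 1 / 2 → g (Function.update z i w) = 0 := by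
        intro w hw
        refine ih _ (fun j hj => ?_) (fun j hj => ?_)
        · have : j ≠ i := fun h => hi (h ▸ hj)
          simpa [this] using hz j (Finset.mem_insert_of_mem hj)
        · by_cases hji : j = i
          · subst hji; simpa using hw
          · simpa [hji] using hz' j (by simp [hji, hj])
      have hacc : AccPt (1 / 2 : ℂ) (Filter.principal (Metric.sphere (0 : ℂ) (1 / 2))) := by
        have hpre : IsPreconnected (Metric.sphere (0 : ℂ) (1 / 2)) :=
          isPreconnected_sphere (by rw [Complex.rank_real_complex]; norm_num) 0 _
        refine hpre.preperfect_of_nontrivial ⟨1 / 2, by simp, -(1 / 2), by simp, ?_⟩ _ (by simp)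
        norm_num
      have hfreq : ∃ᶠ w in nhdsWithin (1 / 2 : ℂ) {1 / 2}ᶜ, g (Function.update z i w) = 0 :=
        (accPt_iff_frequently_nhdsNE.1 hacc).mono fun w hw => hS w (by simpa using hw)
      have hz0 := ha.eqOn_zero_of_preconnected_of_frequently_eq_zero
        (convex_ball (0 : ℂ) 1).isPreconnected (by norm_num) hfreq
      have hzi : z i ∈ Metric.ball (0 : ℂ) 1 := by
        simpa using hz i (Finset.mem_insert_self _ _)
      simpa using hz0 hzi
  funext z
  rw [hfg]
  exact key Finset.univ z (fun j _ => z.2 j) (fun j hj => absurd (Finset.mem_univ j) hj)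

/-- `H^p(𝔻ⁿ)` as a type, to be equipped with its Hardy norm. -/
def Hardy (n : ℕ) (p : ℝ≥0∞) : Type := hardySpace n p

namespace Hardy

variable {n : ℕ} {p : ℝ≥0∞}

instance : AddCommGroup (Hardy n p) := inferInstanceAs (AddCommGroup (hardySpace n p))

instance : Module ℂ (Hardy n p) := inferInstanceAs (Module ℂ (hardySpace n p))

/-- The inclusion of `H^p(𝔻ⁿ)` in the space of all functions on the polydisc. -/
def incl (n : ℕ) (p : ℝ≥0∞) : Hardy n p →ₗ[ℂ] (openPolydisc n → ℂ) := (hardySpace n p).subtype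

theorem incl_mem (f : Hardy n p) : incl n p f ∈ hardySpace n p := f.2

instance [hp : Fact (1 ≤ p)] : NormedAddCommGroup (Hardy n p) :=
  AddGroupNorm.toNormedAddCommGroup
    { toFun := fun f => (hardyNorm p (incl n p f)).toReal
      map_zero' := by simp [hardyNorm_zero]
      add_le' := fun f g => by
        simp only [map_add]
        rw [← ENNReal.toReal_add (incl_mem f).2.ne (incl_mem g).2.ne]
        exact ENNReal.toReal_mono (ENNReal.add_lt_top.2 ⟨(incl_mem f).2, (incl_mem g).2⟩).ne
          (hardyNorm_add_le hp.out (incl_mem f).1 (incl_mem g).1)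
      neg' := fun f => by
        have h := hardyNorm_smul p (-1) (incl n p f)
        rw [neg_one_smul] at h
        simp [h]
      eq_zero_of_map_eq_zero' := fun f hf => by
        have h1 : hardyNorm p (incl n p f) = 0 :=
          ((ENNReal.toReal_eq_zero_iff _).1 hf).resolve_right (incl_mem f).2.ne
        exact Subtype.ext ((incl_mem f).1.eq_zero_of_hardyNorm_eq_zero
          (zero_lt_one.trans_le hp.out).ne' h1) }

theorem norm_def [Fact (1 ≤ p)] (f : Hardy n p) : ‖f‖ = (hardyNorm p (incl n p f)).toReal := rfl

instance [Fact (1 ≤ p)] : NormedSpace ℂ (Hardy n p) where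
  norm_smul_le c f := by simp [norm_def, hardyNorm_smul]

end Hardy

instance fact_one_le_four_ennreal : Fact ((1 : ℝ≥0∞) ≤ 4) := ⟨by norm_num⟩

/-! ### The complex interpolation method

A couple of normed spaces `X₀`, `X₁` is given with injective linear maps `i₀`, `i₁` into a common
vector space `V`. -/

section ComplexInterpolation

variable {X₀ X₁ V : Type*} [NormedAddCommGroup X₀] [NormedSpace ℂ X₀]
  [NormedAddCommGroup X₁] [NormedSpace ℂ X₁] [AddCommGroup V] [Module ℂ V]

/-- The sum `X₀ + X₁` of a couple: the quotient of `X₀ × X₁` by the pairs with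
`i₀ x₀ + i₁ x₁ = 0`, with the quotient norm
`‖v‖ = inf {max ‖x₀‖ ‖x₁‖ : v = i₀ x₀ + i₁ x₁}`, which is equivalent to
`inf {‖x₀‖ + ‖x₁‖ : v = i₀ x₀ + i₁ x₁}`. -/
abbrev CoupleSum (i₀ : X₀ →ₗ[ℂ] V) (i₁ : X₁ →ₗ[ℂ] V) : Type _ :=
  (X₀ × X₁) ⧸ LinearMap.ker (i₀.coprod i₁)

namespace CoupleSum

variable (i₀ : X₀ →ₗ[ℂ] V) (i₁ : X₁ →ₗ[ℂ] V)

/-- The embedding of `X₀` in `X₀ + X₁`. -/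
def inl : X₀ →ₗ[ℂ] CoupleSum i₀ i₁ :=
  (LinearMap.ker (i₀.coprod i₁)).mkQ ∘ₗ LinearMap.inl ℂ X₀ X₁

/-- The embedding of `X₁` in `X₀ + X₁`. -/
def inr : X₁ →ₗ[ℂ] CoupleSum i₀ i₁ :=
  (LinearMap.ker (i₀.coprod i₁)).mkQ ∘ₗ LinearMap.inr ℂ X₀ X₁

/-- The (injective) map `X₀ + X₁ → V`, sending the class of `(x₀, x₁)` to `i₀ x₀ + i₁ x₁`. -/
def toAmbient : CoupleSum i₀ i₁ →ₗ[ℂ] V :=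
  (LinearMap.ker (i₀.coprod i₁)).liftQ (i₀.coprod i₁) le_rfl

end CoupleSum

/-- The admissible functions of the complex method: bounded continuous functions from the strip
`0 ≤ Re z ≤ 1` to `X₀ + X₁`, holomorphic in `0 < Re z < 1`, such that `t ↦ F(it)` is a bounded
continuous function into `X₀` and `t ↦ F(1 + it)` is a bounded continuous function into `X₁`. -/
structure CalderonFunction (i₀ : X₀ →ₗ[ℂ] V) (i₁ : X₁ →ₗ[ℂ] V) where
  /-- the function; only its values on the closed strip matter -/
  toFun : ℂ → CoupleSum i₀ i₁
  /-- the boundary function `t ↦ F(it)` -/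
  left : ℝ →ᵇ X₀
  /-- the boundary function `t ↦ F(1 + it)` -/
  right : ℝ →ᵇ X₁
  continuousOn' : ContinuousOn toFun (Complex.re ⁻¹' Icc 0 1)
  differentiableOn' : DifferentiableOn ℂ toFun (Complex.re ⁻¹' Ioo 0 1)
  bounded' : ∃ M : ℝ, ∀ z : ℂ, z.re ∈ Icc (0 : ℝ) 1 → ‖toFun z‖ ≤ M
  left_eq : ∀ t : ℝ, toFun (t * Complex.I) = CoupleSum.inl i₀ i₁ (left t)
  right_eq : ∀ t : ℝ, toFun (1 + t * Complex.I) = CoupleSum.inr i₀ i₁ (right t)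

/-- The value `F(θ)`, as an element of the ambient space. -/
def CalderonFunction.value {i₀ : X₀ →ₗ[ℂ] V} {i₁ : X₁ →ₗ[ℂ] V} (F : CalderonFunction i₀ i₁)
    (θ : ℝ) : V :=
  CoupleSum.toAmbient i₀ i₁ (F.toFun (θ : ℂ))

/-- `‖F‖ = max (sup_t ‖F(it)‖_{X₀}) (sup_t ‖F(1 + it)‖_{X₁})`. -/
def CalderonFunction.size {i₀ : X₀ →ₗ[ℂ] V} {i₁ : X₁ →ₗ[ℂ] V} (F : CalderonFunction i₀ i₁) :
    ℝ≥0∞ :=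
  max ‖F.left‖ₑ ‖F.right‖ₑ

/-- The complex interpolation space `(X₀, X₁)_θ`, as a subset of the ambient space. -/
def complexInterpolation (i₀ : X₀ →ₗ[ℂ] V) (i₁ : X₁ →ₗ[ℂ] V) (θ : ℝ) : Set V :=
  {v | ∃ F : CalderonFunction i₀ i₁, F.value θ = v}

/-- The norm of `(X₀, X₁)_θ`: the infimum of `‖F‖` over the admissible `F` with `F(θ) = v`
(and `∞` if there is none). -/
def complexInterpolationNorm (i₀ : X₀ →ₗ[ℂ] V) (i₁ : X₁ →ₗ[ℂ] V) (θ : ℝ) (v : V) : ℝ≥0∞ :=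
  ⨅ (F : CalderonFunction i₀ i₁) (_ : F.value θ = v), F.size

end ComplexInterpolation

end

open MeasureTheory Set
open scoped ENNReal NNReal BoundedContinuousFunction

noncomputable section

open scoped ComplexConjugate
open Filter Topology UnitAddTorus

/-! ### The Szegő kernel of the polydisc -/

/-! For the spaces `L^q(𝕋ⁿ)` the interpolation statement is the Riesz–Thorin argument, and the Szegő
projection `P` transfers it to Hardy spaces because `P` maps `L²` to `H²` and `L⁴` to `H⁴`
boundedly. Write `1/p(z) = 1/2 - z/4`, so that `p(θ) = p`.

`H^p` lies in the interpolation space: since `p ≥ 2`, a function `f` of `H^p` is `P g` with `‖g‖_p ≤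
‖f‖`, where `g` is a weak limit in `L²` of the dilations of `f` (`exists_szegoProj_eq`). Write `g =
M σ w` with `M = ‖g‖_p`, `|σ| ≤ 1` and `‖w‖_p ≤ 1`, and take `F(z) = M P(σ w^{p/p(z)})`. Then `F(θ)
= f`, and the boundary norms are at most `M` in `H²` and `2ⁿ M` in `H⁴` (`exists_calderonFunction`).
That `F` is admissible rests on the holomorphy of `s ↦ σ w^s` with values in `L²`
(`PowerFamily.differentiableOn_powLp`).

The `L²` bound for `P` is Parseval. The `L⁴` bound is Cotlar's trick, applied in one coordinate
after another at the cost of a factor `2` each (`torusNorm_four_le_of_add`,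
`exists_trigPoly_nonneg`). The exponents `2` and `4` matter here: squaring takes `L⁴` to `L²`.

The interpolation space lies in `H^p`: restrict `F` to a torus of radius `r < 1`, pair it with the
dual extremal family `σ |v|^{p(1 - 1/p(z))}` for `v = F(θ)(r ·)`, and apply the three lines theorem
(`eLpNorm_value_dilate_le`). This gives constant `1`, and working at fixed `r` avoids boundary
values altogether. -/

instance isProbabilityMeasure_torusMeasure (n : ℕ) : IsProbabilityMeasure (torusMeasure n) := by
  unfold torusMeasure; infer_instance

/-- The function `t ↦ e^{-2πi tⱼ}` on the torus. -/
def conjCharacter {n : ℕ} (j : Fin n) : C(UnitAddTorus (Fin n), ℂ) where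
  toFun t := conj (AddCircle.toCircle (t j) : ℂ)
  continuous_toFun := Complex.continuous_conj.comp
    (continuous_subtype_val.comp (AddCircle.continuous_toCircle.comp (continuous_apply j)))

/-- The Szegő kernel `t ↦ ∏ⱼ (1 - zⱼ e^{-2πi tⱼ})⁻¹`. -/
def szegoKernel {n : ℕ} (z : Fin n → ℂ) : C(UnitAddTorus (Fin n), ℂ) :=
  ∏ j, Ring.inverse (1 - z j • conjCharacter j)

theorem norm_conjCharacter_le {n : ℕ} (j : Fin n) : ‖conjCharacter j‖ ≤ 1 :=
  (ContinuousMap.norm_le _ zero_le_one).2 fun t => by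
    simp [conjCharacter, Circle.norm_coe]

theorem isUnit_one_sub_smul_conjCharacter {n : ℕ} {a : ℂ} (ha : ‖a‖ < 1) (j : Fin n) :
    IsUnit (1 - a • conjCharacter j) := by
  refine isUnit_one_sub_of_norm_lt_one ?_
  rw [norm_smul]
  exact (mul_le_of_le_one_right (norm_nonneg a) (norm_conjCharacter_le j)).trans_lt ha

theorem szegoKernel_apply {n : ℕ} {z : Fin n → ℂ} (hz : z ∈ openPolydisc n)
    (t : UnitAddTorus (Fin n)) :
    szegoKernel z t = ∏ j, (1 - z j * conj (AddCircle.toCircle (t j) : ℂ))⁻¹ := by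
  rw [szegoKernel, ContinuousMap.prod_apply]
  refine Finset.prod_congr rfl fun j _ => ?_
  have h := Ring.inverse_mul_cancel _ (isUnit_one_sub_smul_conjCharacter (hz j) j)
  have h1 := congrArg (fun u : C(UnitAddTorus (Fin n), ℂ) => u t) h
  refine eq_inv_of_mul_eq_one_left ?_
  simpa [conjCharacter] using h1

/-- Inversion is differentiable at the units of the Banach algebra of continuous functions. Treating
the kernel as a vector of that algebra makes `szegoProj g` a continuous functional composed with a
holomorphic map, so no differentiation under the integral sign is needed. -/
theorem differentiableOn_szegoKernel (n : ℕ) :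
    DifferentiableOn ℂ (szegoKernel (n := n)) (openPolydisc n) := by
  intro z hz
  refine DifferentiableAt.differentiableWithinAt ?_
  unfold szegoKernel
  suffices h : ∀ j, DifferentiableAt ℂ
      (fun z : Fin n → ℂ => Ring.inverse (1 - z j • conjCharacter j)) z from
    (HasFDerivAt.finsetProd fun j _ => (h j).hasFDerivAt).differentiableAt
  intro j
  obtain ⟨u, hu⟩ := isUnit_one_sub_smul_conjCharacter (hz j) j
  refine DifferentiableAt.comp z (g := Ring.inverse)
    (f := fun z : Fin n → ℂ => 1 - z j • conjCharacter j) ?_ ?_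
  · exact hu ▸ (hasFDerivAt_ringInverse (𝕜 := ℂ) u).differentiableAt
  · exact (differentiableAt_const _).sub ((differentiableAt_apply j z).smul_const _)

/-- The Szegő projection: the analytic part of an integrable function on the torus, as a function on
the polydisc. -/
def szegoProj {n : ℕ} (g : UnitAddTorus (Fin n) → ℂ) (z : openPolydisc n) : ℂ :=
  ∫ t, szegoKernel z.1 t * g t ∂torusMeasure n

section

variable {n : ℕ} {g h : UnitAddTorus (Fin n) → ℂ}

theorem integrable_continuousMap_mul (s : C(UnitAddTorus (Fin n), ℂ))
    (hg : Integrable g (torusMeasure n)) : Integrable (fun t => s t * g t) (torusMeasure n) :=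
  hg.bdd_mul s.continuous.aestronglyMeasurable (.of_forall s.norm_coe_le_norm)

theorem norm_integral_continuousMap_mul_le (s : C(UnitAddTorus (Fin n), ℂ))
    (hg : Integrable g (torusMeasure n)) :
    ‖∫ t, s t * g t ∂torusMeasure n‖ ≤ ‖s‖ * ∫ t, ‖g t‖ ∂torusMeasure n := by
  rw [← integral_const_mul]
  refine norm_integral_le_of_norm_le (hg.norm.const_mul _) (.of_forall fun t => ?_)
  rw [norm_mul]
  exact mul_le_mul_of_nonneg_right (s.norm_coe_le_norm t) (norm_nonneg _)

theorem isHolomorphicOnPolydisc_szegoProj (hg : Integrable g (torusMeasure n)) :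
    IsHolomorphicOnPolydisc (szegoProj g) := by
  let L : C(UnitAddTorus (Fin n), ℂ) →L[ℂ] ℂ := LinearMap.mkContinuous
    { toFun := fun s => ∫ t, s t * g t ∂torusMeasure n
      map_add' := fun s s' => by
        simp only [ContinuousMap.add_apply, add_mul]
        exact integral_add (integrable_continuousMap_mul s hg) (integrable_continuousMap_mul s' hg)
      map_smul' := fun c s => by
        simp only [ContinuousMap.smul_apply, smul_eq_mul, mul_assoc, RingHom.id_apply]
        exact integral_const_mul c _ }
    (∫ t, ‖g t‖ ∂torusMeasure n) fun s => by
      rw [mul_comm]; exact norm_integral_continuousMap_mul_le s hg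
  exact ⟨fun z => L (szegoKernel z),
    L.differentiable.comp_differentiableOn (differentiableOn_szegoKernel n), fun z => rfl⟩

theorem szegoProj_add (hg : Integrable g (torusMeasure n)) (hh : Integrable h (torusMeasure n)) :
    szegoProj (g + h) = szegoProj g + szegoProj h := by
  funext z
  simp only [szegoProj, Pi.add_apply, mul_add]
  exact integral_add (integrable_continuousMap_mul _ hg) (integrable_continuousMap_mul _ hh)

theorem szegoProj_smul (c : ℂ) (g : UnitAddTorus (Fin n) → ℂ) :
    szegoProj (c • g) = c • szegoProj g := by
  funext z
  simp only [szegoProj, Pi.smul_apply, smul_eq_mul, mul_left_comm _ c]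
  exact integral_const_mul c _

theorem szegoProj_congr_ae (hgh : g =ᵐ[torusMeasure n] h) : szegoProj g = szegoProj h := by
  funext z
  exact integral_congr_ae (hgh.mono fun t ht => by simp only [ht])

end

/-! ### Cauchy's formula -/

theorem integral_haarAddCircle_eq_circleAverage (F : ℂ → ℂ) :
    ∫ t : UnitAddCircle, F (AddCircle.toCircle t) ∂AddCircle.haarAddCircle
      = Real.circleAverage F 0 1 := by
  rw [AddCircle.integral_haarAddCircle, ← UnitAddCircle.intervalIntegral_preimage 0,
    Real.circleAverage_def]
  have h := intervalIntegral.integral_comp_mul_left (a := 0) (b := 1)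
    (fun θ : ℝ => F (circleMap 0 1 θ)) (c := 2 * Real.pi) (by positivity)
  simp only [mul_zero, mul_one] at h
  rw [← h]
  simp only [zero_add, inv_one, one_smul]
  congr 1
  funext x
  rw [AddCircle.toCircle_apply_mk]
  simp [circleMap]

theorem integral_szego_factor_mul {F : ℂ → ℂ} (hF : DiffContOnCl ℂ F (Metric.ball 0 1)) {z : ℂ}
    (hz : ‖z‖ < 1) :
    ∫ t : UnitAddCircle, (1 - z * conj (AddCircle.toCircle t : ℂ))⁻¹ * F (AddCircle.toCircle t)
      ∂AddCircle.haarAddCircle = F z := by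
  rw [integral_haarAddCircle_eq_circleAverage (fun w => (1 - z * conj w)⁻¹ * F w)]
  rw [← DiffContOnCl.circleAverage_smul_div (R := 1) (c := 0) (f := F) (w := z) (by simpa using hF)
    (by simpa using hz)]
  -- On `|w| = 1` the conjugate of `w` is `w⁻¹`, so `(1 - z w⁻¹)⁻¹ = w / (w - z)`, the weight in
  -- Cauchy's formula written as a circle average.
  refine Real.circleAverage_congr_sphere fun w hw => ?_
  have hw1 : ‖w‖ = 1 := by simpa using hw
  have hw0 : w ≠ 0 := by
    intro h; simp [h] at hw1
  have hcw : conj w = w⁻¹ := by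
    rw [Complex.inv_def, Complex.normSq_eq_norm_sq, hw1]; simp
  simp only [hcw, smul_eq_mul, sub_zero]
  congr 1
  have hwz : w - z ≠ 0 := by
    intro h
    rw [sub_eq_zero] at h
    rw [← h, hw1] at hz
    exact lt_irrefl _ hz
  rw [eq_div_iff hwz, inv_mul_eq_iff_eq_mul₀]
  · field_simp
  · intro h
    apply hwz
    field_simp at h
    simpa using h

theorem fourier_eq_zpow (k : ℤ) (t : UnitAddCircle) :
    fourier k t = (AddCircle.toCircle t : ℂ) ^ k := by
  rw [fourier_apply, AddCircle.toCircle_zsmul, Circle.coe_zpow]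

theorem integral_szego_factor_mul_fourier {z : ℂ} (hz : ‖z‖ < 1) (k : ℤ) :
    ∫ t : UnitAddCircle, (1 - z * conj (AddCircle.toCircle t : ℂ))⁻¹ * fourier k t
      ∂AddCircle.haarAddCircle = if 0 ≤ k then z ^ k.toNat else 0 := by
  split_ifs with hk
  · obtain ⟨m, rfl⟩ := Int.eq_ofNat_of_zero_le hk
    have h := integral_szego_factor_mul (F := fun w => w ^ m)
      (differentiable_id.pow m).diffContOnCl hz
    simpa only [fourier_eq_zpow, zpow_natCast, Int.toNat_natCast] using h
  · obtain ⟨m, hm⟩ := Int.eq_ofNat_of_zero_le (show 0 ≤ -k by omega)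
    have hm0 : m ≠ 0 := by omega
    obtain rfl : k = -(m : ℤ) := by omega
    have hne : ∀ w ∈ Metric.closedBall (0 : ℂ) 1, 1 - conj z * w ≠ 0 := by
      intro w hw h0
      have h1 : ‖conj z * w‖ < 1 := by
        rw [norm_mul, Complex.norm_conj]
        have : ‖w‖ ≤ 1 := by simpa using hw
        exact (mul_le_of_le_one_right (norm_nonneg z) this).trans_lt hz
      rw [← sub_eq_zero.1 h0] at h1
      simp at h1
    -- For `k = -m < 0` the conjugate of the integrand is the boundary value of this holomorphic
    -- function; its mean is its value at `0`, which vanishes because `m ≠ 0`.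
    have hd : DiffContOnCl ℂ (fun w => (1 - conj z * w)⁻¹ * w ^ m) (Metric.ball 0 1) := by
      refine DifferentiableOn.diffContOnCl fun w hw => ?_
      rw [closure_ball _ one_ne_zero] at hw
      refine DifferentiableAt.differentiableWithinAt (DifferentiableAt.mul ?_ ?_)
      · exact DifferentiableAt.inv (by fun_prop) (hne w hw)
      · fun_prop
    have h := integral_szego_factor_mul hd (z := 0) (by simp)
    simp only [zero_mul, sub_zero, inv_one, one_mul, mul_zero] at h
    rw [zero_pow hm0] at h
    rw [← map_zero (starRingEnd ℂ), ← h, ← integral_conj]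
    refine integral_congr_ae (.of_forall fun t => ?_)
    have hc : conj (AddCircle.toCircle t : ℂ) = (AddCircle.toCircle t : ℂ)⁻¹ := by
      rw [← Circle.coe_inv_eq_conj, Circle.coe_inv]
    simp only [fourier_eq_zpow, map_mul, map_inv₀, map_sub, map_one, map_pow, Complex.conj_conj,
      zpow_neg, zpow_natCast, hc, inv_pow]

theorem integrable_torusMeasure_of_continuous {n : ℕ} {F : UnitAddTorus (Fin n) → ℂ}
    (hF : Continuous F) : Integrable F (torusMeasure n) :=
  hF.integrable_of_hasCompactSupport (HasCompactSupport.of_compactSpace F)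

/-- The dilate of `f` is holomorphic past the closed polydisc, so Cauchy's formula applies in each
variable: Fubini splits off the first circle, and the other variables are handled by induction. -/
theorem szegoProj_dilate {n : ℕ} {f : openPolydisc n → ℂ} (hf : IsHolomorphicOnPolydisc f)
    (r : Ico (0 : ℝ) 1) (z : openPolydisc n) (w : openPolydisc n)
    (hw : ∀ j, w.1 j = r * z.1 j) :
    szegoProj (fun t => f (dilatedTorusPoint r t)) z = f w := by
  induction n with
  | zero =>
    have h : ∀ t, dilatedTorusPoint r t = w := fun t => Subtype.ext (funext fun j => j.elim0)
    simp [szegoProj, h, szegoKernel]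
  | succ n ih =>
    obtain ⟨g, hg, hfg⟩ := hf
    have hcont : Continuous fun t => szegoKernel z.1 t * f (dilatedTorusPoint r t) :=
      (szegoKernel z.1).continuous.mul
        (IsHolomorphicOnPolydisc.continuous_dilate ⟨g, hg, hfg⟩ r)
    have hint := integrable_torusMeasure_of_continuous hcont
    have hmp := (measurePreserving_piFinSuccAbove
      (fun _ : Fin (n + 1) => (AddCircle.haarAddCircle : Measure UnitAddCircle)) 0).symm
    have hcons : ∀ (a : ℂ) (b : Fin n → ℂ), ‖a‖ < 1 → b ∈ openPolydisc n →
        Fin.cons (α := fun _ => ℂ) a b ∈ openPolydisc (n + 1) := by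
      intro a b ha hb j
      refine Fin.cases ?_ (fun i => ?_) j
      · simpa using ha
      · simpa using hb i
    have hrn : ∀ a : ℂ, ‖a‖ ≤ 1 → ‖(r : ℂ) * a‖ < 1 := by
      intro a ha
      rw [norm_mul, Complex.norm_of_nonneg r.2.1]
      exact (mul_le_of_le_one_right r.2.1 ha).trans_lt r.2.2
    let z' : openPolydisc n := ⟨Fin.tail z.1, fun j => z.2 j.succ⟩
    let w' : openPolydisc n := ⟨Fin.tail w.1, fun j => w.2 j.succ⟩
    have key : ∀ t₀ : UnitAddCircle, ∫ t, szegoKernel z'.1 t *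
        g (Fin.cons (α := fun _ => ℂ) (r * (AddCircle.toCircle t₀ : ℂ)) (dilatedTorusPoint r t).1)
          ∂torusMeasure n
        = g (Fin.cons (α := fun _ => ℂ) (r * (AddCircle.toCircle t₀ : ℂ)) w'.1) := by
      intro t₀
      refine ih (f := fun u => g (Fin.cons (α := fun _ => ℂ)
        (r * (AddCircle.toCircle t₀ : ℂ)) u.1)) ⟨fun u => g (Fin.cons (α := fun _ => ℂ)
        (r * (AddCircle.toCircle t₀ : ℂ)) u), ?_, fun u => rfl⟩ z' w' fun j => hw j.succ
      refine hg.comp (fun u _ => DifferentiableAt.differentiableWithinAt ?_) fun u hu =>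
        hcons _ _ (hrn _ (by simp [Circle.norm_coe])) hu
      refine differentiableAt_pi.2 fun j => ?_
      refine Fin.cases ?_ (fun i => ?_) j
      · simp
      · simpa using differentiableAt_apply i u
    have hd : DiffContOnCl ℂ (fun a => g (Fin.cons (α := fun _ => ℂ) (r * a) w'.1))
        (Metric.ball 0 1) := by
      refine DifferentiableOn.diffContOnCl ?_
      rw [closure_ball _ one_ne_zero]
      refine hg.comp (fun u _ => DifferentiableAt.differentiableWithinAt ?_) fun u hu =>
        hcons _ _ (hrn u (by simpa using hu)) w'.2
      refine differentiableAt_pi.2 fun j => ?_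
      refine Fin.cases ?_ (fun i => ?_) j
      · simp only [Fin.cons_zero]; fun_prop
      · simp
    have hw0 : g (Fin.cons (α := fun _ => ℂ) (r * z.1 0) w'.1) = f w := by
      rw [hfg, ← hw 0]
      exact congrArg g (Fin.cons_self_tail w.1)
    rw [← hw0, ← integral_szego_factor_mul hd (z.2 0)]
    have hval : ∀ (t₀ : UnitAddCircle) (t : UnitAddTorus (Fin n)),
        szegoKernel z.1 (Fin.cons (α := fun _ => UnitAddCircle) t₀ t) *
          f (dilatedTorusPoint r (Fin.cons (α := fun _ => UnitAddCircle) t₀ t))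
        = (1 - z.1 0 * conj (AddCircle.toCircle t₀ : ℂ))⁻¹ * (szegoKernel z'.1 t *
          g (Fin.cons (α := fun _ => ℂ) (r * (AddCircle.toCircle t₀ : ℂ))
            (dilatedTorusPoint r t).1)) := by
      intro t₀ t
      rw [szegoKernel_apply z.2, szegoKernel_apply z'.2, Fin.prod_univ_succ, hfg, mul_assoc]
      congr 2
      refine congrArg g (funext fun j => ?_)
      refine Fin.cases ?_ (fun i => ?_) j
      · simp [dilatedTorusPoint]
      · simp [dilatedTorusPoint]
    have hint' := (hmp.integrable_comp_emb (MeasurableEquiv.measurableEmbedding _)).2 hint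
    have h1 := hmp.integral_comp' (fun t => szegoKernel z.1 t * f (dilatedTorusPoint r t))
    refine (Eq.symm h1).trans ?_
    refine (integral_prod _ hint').trans ?_
    refine integral_congr_ae (.of_forall fun t₀ => ?_)
    simp only
    rw [← key t₀, ← integral_const_mul]
    refine integral_congr_ae (.of_forall fun t => ?_)
    have hc : (MeasurableEquiv.piFinSuccAbove (fun _ : Fin (n + 1) => UnitAddCircle) 0).symm (t₀, t)
        = Fin.cons (α := fun _ => UnitAddCircle) t₀ t := Fin.insertNth_zero' t₀ t
    refine Eq.trans ?_ (hval t₀ t)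
    rw [← hc]
    rfl

/-- The value of the monomial with exponent `k` at `z`, or `0` if an exponent is negative. -/
def analyticMonomial {n : ℕ} (k : Fin n → ℤ) (z : Fin n → ℂ) : ℂ :=
  ∏ j, if 0 ≤ k j then z j ^ (k j).toNat else 0

theorem szegoProj_mFourier {n : ℕ} (k : Fin n → ℤ) (z : openPolydisc n) :
    szegoProj (mFourier k) z = analyticMonomial k z.1 := by
  have h : ∀ t, szegoKernel z.1 t * mFourier k t
      = ∏ j, (1 - z.1 j * conj (AddCircle.toCircle (t j) : ℂ))⁻¹ * fourier (k j) (t j) := by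
    intro t
    rw [szegoKernel_apply z.2, Finset.prod_mul_distrib]
    rfl
  simp only [szegoProj, h, torusMeasure]
  rw [integral_fintype_prod_eq_prod
    (fun j (t : UnitAddCircle) => (1 - z.1 j * conj (AddCircle.toCircle t : ℂ))⁻¹ * fourier (k j) t)]
  exact Finset.prod_congr rfl fun j _ => integral_szego_factor_mul_fourier (z.2 j) (k j)

/-! ### Trigonometric polynomials -/

section TrigonometricPolynomials

variable {n : ℕ}

/-- The Szegő projection of continuous functions, as a linear map. -/
def szegoProjₗ (n : ℕ) : C(UnitAddTorus (Fin n), ℂ) →ₗ[ℂ] (openPolydisc n → ℂ) where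
  toFun g := szegoProj g
  map_add' g h := szegoProj_add (integrable_torusMeasure_of_continuous g.continuous)
    (integrable_torusMeasure_of_continuous h.continuous)
  map_smul' c g := szegoProj_smul c g

/-- The norm in `L^p(𝕋ⁿ)` of a continuous function. -/
def torusNorm (p : ℝ≥0∞) (g : C(UnitAddTorus (Fin n), ℂ)) : ℝ :=
  (eLpNorm g p (torusMeasure n)).toReal

theorem eLpNorm_continuousMap_lt_top (p : ℝ≥0∞) (g : C(UnitAddTorus (Fin n), ℂ)) :
    eLpNorm g p (torusMeasure n) < ∞ :=
  (MemLp.of_bound g.continuous.aestronglyMeasurable ‖g‖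
    (.of_forall g.norm_coe_le_norm)).eLpNorm_lt_top

theorem torusNorm_nonneg (p : ℝ≥0∞) (g : C(UnitAddTorus (Fin n), ℂ)) : 0 ≤ torusNorm p g :=
  ENNReal.toReal_nonneg

theorem torusNorm_eq_norm_toLp (p : ℝ≥0∞) [Fact (1 ≤ p)] (g : C(UnitAddTorus (Fin n), ℂ)) :
    torusNorm p g = ‖ContinuousMap.toLp (E := ℂ) p (torusMeasure n) ℂ g‖ := by
  rw [torusNorm, Lp.norm_def, eLpNorm_congr_ae (ContinuousMap.coeFn_toLp (torusMeasure n) g)]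

theorem torusNorm_add_le (p : ℝ≥0∞) [Fact (1 ≤ p)] (g h : C(UnitAddTorus (Fin n), ℂ)) :
    torusNorm p (g + h) ≤ torusNorm p g + torusNorm p h := by
  simp only [torusNorm_eq_norm_toLp, map_add]
  exact norm_add_le _ _

theorem torusNorm_sub_le (p : ℝ≥0∞) [Fact (1 ≤ p)] (g h : C(UnitAddTorus (Fin n), ℂ)) :
    torusNorm p (g - h) ≤ torusNorm p g + torusNorm p h := by
  simp only [torusNorm_eq_norm_toLp, map_sub]
  exact norm_sub_le _ _

theorem torusNorm_smul (p : ℝ≥0∞) [Fact (1 ≤ p)] (c : ℂ) (g : C(UnitAddTorus (Fin n), ℂ)) :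
    torusNorm p (c • g) = ‖c‖ * torusNorm p g := by
  simp only [torusNorm_eq_norm_toLp, map_smul, norm_smul]

theorem torusNorm_two_mul_le (g h : C(UnitAddTorus (Fin n), ℂ)) :
    torusNorm 2 (g * h) ≤ torusNorm 4 g * torusNorm 4 h := by
  have : ENNReal.HolderTriple 4 4 2 := ⟨by
    have h4 : (4 : ℝ≥0∞) = 2 * 2 := by norm_num
    rw [← two_mul, h4, ENNReal.mul_inv (by simp) (by simp), ← mul_assoc,
      ENNReal.mul_inv_cancel (by simp) (by simp), one_mul]⟩
  rw [torusNorm, torusNorm, torusNorm, ← ENNReal.toReal_mul]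
  refine ENNReal.toReal_mono (ENNReal.mul_lt_top (eLpNorm_continuousMap_lt_top 4 g)
    (eLpNorm_continuousMap_lt_top 4 h)).ne ?_
  have key := eLpNorm_smul_le_mul_eLpNorm (p := 4) (q := 4) (r := 2) (μ := torusMeasure n) (f := h)
    (φ := g) h.continuous.aestronglyMeasurable g.continuous.aestronglyMeasurable
  rwa [smul_eq_mul, ← ContinuousMap.coe_mul] at key

theorem eLpNorm_two_mul_self {α : Type*} [MeasurableSpace α] (μ : Measure α) (g : α → ℂ) :
    eLpNorm (fun t => g t * g t) 2 μ = eLpNorm g 4 μ ^ 2 := by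
  have h := eLpNorm_norm_rpow (μ := μ) (p := 2) g (q := 2) (by norm_num)
  have h4 : (2 : ℝ≥0∞) * ENNReal.ofReal 2 = 4 := by norm_num
  rw [h4, ENNReal.rpow_ofNat] at h
  rw [← h]
  refine eLpNorm_congr_norm_ae (.of_forall fun t => ?_)
  simp [pow_two]

theorem torusNorm_two_mul_self (g : C(UnitAddTorus (Fin n), ℂ)) :
    torusNorm 2 (g * g) = torusNorm 4 g ^ 2 := by
  rw [torusNorm, torusNorm, ← ENNReal.toReal_pow, ← eLpNorm_two_mul_self]
  rfl

theorem orthonormal_mFourier_toLp (n : ℕ) :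
    Orthonormal ℂ fun k : Fin n → ℤ =>
      ContinuousMap.toLp (E := ℂ) 2 (torusMeasure n) ℂ (mFourier k) :=
  orthonormal_mFourier

/-- The trigonometric polynomials with frequencies in `S`. -/
def trigPoly (S : Set (Fin n → ℤ)) : Submodule ℂ C(UnitAddTorus (Fin n), ℂ) :=
  Submodule.span ℂ (mFourier '' S)

theorem trigPoly_mono {S T : Set (Fin n → ℤ)} (h : S ⊆ T) : trigPoly S ≤ trigPoly T :=
  Submodule.span_mono (image_mono h)

theorem mul_mem_trigPoly {S : Set (Fin n → ℤ)} (hS : ∀ k ∈ S, ∀ l ∈ S, k + l ∈ S)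
    {g h : C(UnitAddTorus (Fin n), ℂ)} (hg : g ∈ trigPoly S) (hh : h ∈ trigPoly S) :
    g * h ∈ trigPoly S := by
  have h1 : trigPoly S * trigPoly S ≤ trigPoly S := by
    rw [trigPoly, Submodule.span_mul_span, Submodule.span_le]
    rintro _ ⟨_, ⟨k, hk, rfl⟩, _, ⟨l, hl, rfl⟩, rfl⟩
    refine Submodule.subset_span ⟨k + l, hS k hk l hl, ?_⟩
    ext t
    exact mFourier_add
  exact h1 (Submodule.mul_mem_mul hg hh)

/-- Disjoint spectra make `g` and `h` orthogonal in `L²`, so the sign of `h` does not affect the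
norm. -/
theorem torusNorm_two_sub_eq_add {S : Set (Fin n → ℤ)} {g h : C(UnitAddTorus (Fin n), ℂ)}
    (hg : g ∈ trigPoly S) (hh : h ∈ trigPoly Sᶜ) : torusNorm 2 (g - h) = torusNorm 2 (g + h) := by
  simp only [torusNorm_eq_norm_toLp, map_sub, map_add]
  set L := ContinuousMap.toLp (E := ℂ) 2 (torusMeasure n) ℂ
  have hortho : Submodule.map L.toLinearMap (trigPoly S) ⟂
      Submodule.map L.toLinearMap (trigPoly Sᶜ) := by
    rw [trigPoly, trigPoly, Submodule.map_span, Submodule.map_span, Submodule.isOrtho_span]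
    rintro _ ⟨_, ⟨k, hk, rfl⟩, rfl⟩ _ ⟨_, ⟨l, hl, rfl⟩, rfl⟩
    exact (orthonormal_mFourier_toLp n).2 fun hkl => hl (hkl ▸ hk)
  have h0 : inner ℂ (L g) (L h) = 0 := Submodule.isOrtho_iff_inner_eq.1 hortho _
    (Submodule.mem_map_of_mem hg) _ (Submodule.mem_map_of_mem hh)
  have h1 := norm_add_sq_eq_norm_sq_add_norm_sq_of_inner_eq_zero _ _ h0
  have h2 := norm_sub_sq (𝕜 := ℂ) (L g) (L h)
  rw [h0, map_zero] at h2
  nlinarith [norm_nonneg (L g - L h), norm_nonneg (L g + L h)]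

/-- Cotlar's inequality: the projection on frequencies in `S` is bounded in `L⁴` if both `S` and its
complement are closed under addition. -/
theorem torusNorm_four_le_of_add {S : Set (Fin n → ℤ)} (hS : ∀ k ∈ S, ∀ l ∈ S, k + l ∈ S)
    (hS' : ∀ k ∈ Sᶜ, ∀ l ∈ Sᶜ, k + l ∈ Sᶜ) {g h : C(UnitAddTorus (Fin n), ℂ)}
    (hg : g ∈ trigPoly S) (hh : h ∈ trigPoly Sᶜ) : torusNorm 4 g ≤ 2 * torusNorm 4 (g + h) := by
  set x := torusNorm 4 (g - h)
  set y := torusNorm 4 (g + h)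
  have hx : 0 ≤ x := torusNorm_nonneg _ _
  have hy : 0 ≤ y := torusNorm_nonneg _ _
  -- The squares `g²` and `h²` still have spectra in `S` and its complement, so `g² + h²` has the
  -- `L²` norm of `g² - h² = (g - h)(g + h)`, which Hölder bounds by `x y`.
  have h1 : x ^ 2 ≤ 2 * (x * y) + y ^ 2 := by
    have e : (g - h) * (g - h) = (2 : ℂ) • (g * g + h * h) - (g + h) * (g + h) := by
      ext t
      simp only [ContinuousMap.sub_apply, ContinuousMap.mul_apply, ContinuousMap.smul_apply,
        ContinuousMap.add_apply, smul_eq_mul]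
      ring
    have e' : g * g - h * h = (g - h) * (g + h) := by ring
    rw [← torusNorm_two_mul_self, ← torusNorm_two_mul_self, e]
    refine (torusNorm_sub_le _ _ _).trans (add_le_add_left ?_ _)
    rw [torusNorm_smul, ← torusNorm_two_sub_eq_add (mul_mem_trigPoly hS hg hg)
      (mul_mem_trigPoly hS' hh hh), e', Complex.norm_ofNat]
    exact mul_le_mul_of_nonneg_left (torusNorm_two_mul_le _ _) zero_le_two
  -- The quadratic inequality gives `x ≤ (1 + √2) y`; rounding up to `3` yields the final constant
  -- `(1 + 3) / 2 = 2`.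
  have h2 : x ≤ 3 * y := by
    by_contra! h3
    nlinarith
  have e : g = (1 / 2 : ℂ) • ((g + h) + (g - h)) := by
    rw [add_add_sub_cancel, ← two_smul ℂ g, smul_smul]; norm_num
  have h3 : torusNorm 4 g ≤ 1 / 2 * (y + x) := by
    calc torusNorm 4 g = 1 / 2 * torusNorm 4 ((g + h) + (g - h)) := by
          rw [show (1 / 2 : ℝ) = ‖(1 / 2 : ℂ)‖ by norm_num, ← torusNorm_smul, ← e]
      _ ≤ _ := mul_le_mul_of_nonneg_left (torusNorm_add_le _ _ _) (by norm_num)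
  linarith

/-- On analytic polynomials the Szegő projection is holomorphic extension, hence multiplicative;
this permits the squaring that derives the `H⁴` bound from the `H²` bound. -/
theorem szegoProj_mul_of_mem_trigPoly {g h : C(UnitAddTorus (Fin n), ℂ)}
    (hg : g ∈ trigPoly {k | ∀ j, 0 ≤ k j}) (hh : h ∈ trigPoly {k | ∀ j, 0 ≤ k j}) :
    szegoProj (g * h : C(UnitAddTorus (Fin n), ℂ)) = szegoProj g * szegoProj h := by
  change szegoProjₗ n (g * h) = szegoProjₗ n g * szegoProjₗ n h
  unfold trigPoly at hg hh
  induction hg using Submodule.span_induction with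
  | zero => simp
  | add x y _ _ hx hy => rw [add_mul, map_add, map_add, hx, hy, add_mul]
  | smul c x _ hx => rw [smul_mul_assoc, map_smul, map_smul, hx, smul_mul_assoc]
  | mem x hx =>
    obtain ⟨k, hk, rfl⟩ := hx
    induction hh using Submodule.span_induction with
    | zero => simp
    | add x y _ _ hx hy => rw [mul_add, map_add, map_add, hx, hy, mul_add]
    | smul c x _ hx => rw [mul_smul_comm, map_smul, map_smul, hx, mul_smul_comm]
    | mem x hx =>
      obtain ⟨l, hl, rfl⟩ := hx
      have e : mFourier k * mFourier l = mFourier (d := Fin n) (k + l) := by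
        ext t; exact mFourier_add.symm
      funext z
      rw [e]
      refine (szegoProj_mFourier _ z).trans ?_
      refine Eq.trans ?_ (congrArg₂ (· * ·) (szegoProj_mFourier k z) (szegoProj_mFourier l z)).symm
      simp only [analyticMonomial, ← Finset.prod_mul_distrib]
      refine Finset.prod_congr rfl fun j _ => ?_
      have hk' := hk j
      have hl' := hl j
      simp only [Pi.add_apply, hk', hl', add_nonneg, if_true, ← pow_add, Int.toNat_add]

/-- Cotlar's inequality does not apply to the orthant directly, since for `n ≥ 2` its complement is
not closed under addition. It does apply to each half-space `0 ≤ k i`. The part discarded at each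
stage has a negative `i`-th exponent, so the Szegő projection kills it. -/
theorem exists_trigPoly_nonneg {g : C(UnitAddTorus (Fin n), ℂ)} (hg : g ∈ trigPoly univ)
    (s : Finset (Fin n)) : ∃ h ∈ trigPoly {k | ∀ j ∈ s, 0 ≤ k j},
      szegoProj h = szegoProj g ∧ torusNorm 4 h ≤ 2 ^ s.card * torusNorm 4 g := by
  induction s using Finset.induction_on with
  | empty => exact ⟨g, trigPoly_mono (by simp) hg, rfl, by simp⟩
  | insert i s hi ih =>
    obtain ⟨h, hh, hP, hN⟩ := ih
    have hU : {k : Fin n → ℤ | ∀ j ∈ s, 0 ≤ k j} ⊆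
        {k | ∀ j ∈ insert i s, 0 ≤ k j} ∪ {k | 0 ≤ k i}ᶜ := by
      intro k hk
      by_cases hki : 0 ≤ k i
      · exact Or.inl (by simpa [hki] using hk)
      · exact Or.inr hki
    have hh' := trigPoly_mono hU hh
    rw [trigPoly, image_union, Submodule.span_union, Submodule.mem_sup] at hh'
    obtain ⟨h₁, hh₁, h₂, hh₂, rfl⟩ := hh'
    refine ⟨h₁, hh₁, ?_, ?_⟩
    · rw [← hP]
      have h0 : trigPoly {k : Fin n → ℤ | 0 ≤ k i}ᶜ ≤ LinearMap.ker (szegoProjₗ n) := by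
        rw [trigPoly, Submodule.span_le]
        rintro _ ⟨k, hk, rfl⟩
        refine LinearMap.mem_ker.2 (funext fun z => (szegoProj_mFourier k z).trans ?_)
        exact Finset.prod_eq_zero (Finset.mem_univ i) (if_neg hk)
      have h1 := map_add (szegoProjₗ n) h₁ h₂
      rw [LinearMap.mem_ker.1 (h0 hh₂), add_zero] at h1
      exact h1.symm
    · rw [Finset.card_insert_of_notMem hi, pow_succ']
      have hsub : {k : Fin n → ℤ | ∀ j ∈ insert i s, 0 ≤ k j} ⊆ {k | 0 ≤ k i} :=
        fun k hk => hk i (Finset.mem_insert_self i s)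
      have h1 := torusNorm_four_le_of_add (S := {k : Fin n → ℤ | 0 ≤ k i})
        (fun k hk l hl => show 0 ≤ k i + l i from add_nonneg hk hl)
        (fun k hk l hl => by
          simp only [mem_compl_iff, mem_ofPred_eq, not_le, Pi.add_apply] at hk hl ⊢
          exact add_neg hk hl) (trigPoly_mono hsub hh₁) hh₂
      rw [mul_assoc]
      exact h1.trans (mul_le_mul_of_nonneg_left hN zero_le_two)

theorem analyticMonomial_dilatedTorusPoint (k : Fin n → ℤ) (r : Ico (0 : ℝ) 1)
    (t : UnitAddTorus (Fin n)) : analyticMonomial k (dilatedTorusPoint r t).1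
      = analyticMonomial k (fun _ => ((r : ℝ) : ℂ)) * mFourier k t := by
  have h : mFourier k t = ∏ j, fourier (k j) (t j) := rfl
  rw [h, analyticMonomial, analyticMonomial, ← Finset.prod_mul_distrib]
  refine Finset.prod_congr rfl fun j _ => ?_
  split_ifs with hj
  · obtain ⟨m, hm⟩ := Int.eq_ofNat_of_zero_le hj
    rw [hm, fourier_eq_zpow]
    simp [dilatedTorusPoint, mul_pow]
  · simp

theorem norm_analyticMonomial_le (k : Fin n → ℤ) (r : Ico (0 : ℝ) 1) :
    ‖analyticMonomial k (fun _ => ((r : ℝ) : ℂ))‖ ≤ 1 := by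
  rw [analyticMonomial, norm_prod]
  refine Finset.prod_le_one (fun j _ => norm_nonneg _) fun j _ => ?_
  split_ifs
  · rw [norm_pow, Complex.norm_of_nonneg r.2.1]
    exact pow_le_one₀ r.2.1 r.2.2.le
  · simp

/-- Projecting and dilating multiplies each Fourier coefficient by a power of `r` or by `0`, so
Parseval gives a contraction. -/
theorem eLpNorm_two_szegoProj_trigPoly_le {g : C(UnitAddTorus (Fin n), ℂ)}
    (hg : g ∈ trigPoly univ) (r : Ico (0 : ℝ) 1) :
    eLpNorm (fun t => szegoProj g (dilatedTorusPoint r t)) 2 (torusMeasure n)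
      ≤ eLpNorm g 2 (torusMeasure n) := by
  rw [trigPoly, image_univ, Finsupp.mem_span_range_iff_exists_finsupp] at hg
  obtain ⟨c, rfl⟩ := hg
  let d : (Fin n → ℤ) → ℂ := fun k => c k * analyticMonomial k (fun _ => ((r : ℝ) : ℂ))
  have h1 : (fun t => szegoProj (c.sum fun k a => a • mFourier k : C(UnitAddTorus (Fin n), ℂ))
      (dilatedTorusPoint r t))
      = (∑ k ∈ c.support, d k • mFourier k : C(UnitAddTorus (Fin n), ℂ)) := by
    funext t
    change szegoProjₗ n _ _ = _
    rw [Finsupp.sum, map_sum, Finset.sum_apply, ContinuousMap.sum_apply]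
    refine Finset.sum_congr rfl fun k _ => ?_
    rw [map_smul, Pi.smul_apply]
    have e : szegoProjₗ n (mFourier k) (dilatedTorusPoint r t) = _ :=
      szegoProj_mFourier k (dilatedTorusPoint r t)
    rw [e, analyticMonomial_dilatedTorusPoint, ContinuousMap.smul_apply, smul_eq_mul, smul_eq_mul,
      ← mul_assoc]
  have key : ∀ b : (Fin n → ℤ) → ℂ,
      torusNorm 2 (∑ k ∈ c.support, b k • mFourier k) ^ 2 = ∑ k ∈ c.support, ‖b k‖ ^ 2 := by
    intro b
    rw [torusNorm_eq_norm_toLp, map_sum]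
    simp only [map_smul]
    have h := (orthonormal_mFourier_toLp n).inner_sum b b c.support
    rw [inner_self_eq_norm_sq_to_K] at h
    have h' := congrArg Complex.re h
    simpa [← Complex.ofReal_pow, Complex.conj_mul'] using h'
  rw [h1, Finsupp.sum]
  refine (ENNReal.toReal_le_toReal (eLpNorm_continuousMap_lt_top _ _).ne
    (eLpNorm_continuousMap_lt_top _ _).ne).1 ?_
  change torusNorm 2 _ ≤ torusNorm 2 _
  refine (sq_le_sq₀ (torusNorm_nonneg _ _) (torusNorm_nonneg _ _)).1 ?_
  rw [key d, key c]
  refine Finset.sum_le_sum fun k _ => ?_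
  refine pow_le_pow_left₀ (norm_nonneg _) ?_ 2
  rw [norm_mul]
  exact mul_le_of_le_one_right (norm_nonneg _) (norm_analyticMonomial_le k r)

/-- Replace `g` by an analytic polynomial `h` with the same projection. Then `‖P h(r ·)‖₄² =
‖P(h²)(r ·)‖₂ ≤ ‖h²‖₂ = ‖h‖₄²`, so dilation is controlled in `L⁴` without a Poisson kernel. -/
theorem eLpNorm_four_szegoProj_trigPoly_le {g : C(UnitAddTorus (Fin n), ℂ)}
    (hg : g ∈ trigPoly univ) (r : Ico (0 : ℝ) 1) :
    eLpNorm (fun t => szegoProj g (dilatedTorusPoint r t)) 4 (torusMeasure n)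
      ≤ 2 ^ n * eLpNorm g 4 (torusMeasure n) := by
  obtain ⟨h, hh, hP, hN⟩ := exists_trigPoly_nonneg hg Finset.univ
  simp only [Finset.mem_univ, forall_const, Finset.card_univ, Fintype.card_fin] at hh hN
  have h1 : eLpNorm h 4 (torusMeasure n) ≤ 2 ^ n * eLpNorm g 4 (torusMeasure n) := by
    rw [← ENNReal.toReal_le_toReal (eLpNorm_continuousMap_lt_top _ _).ne
      (ENNReal.mul_lt_top (by simp) (eLpNorm_continuousMap_lt_top _ _)).ne, ENNReal.toReal_mul]
    simpa [torusNorm] using hN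
  refine le_trans ?_ h1
  rw [← hP, ← ENNReal.pow_le_pow_left_iff two_ne_zero, ← eLpNorm_two_mul_self,
    ← eLpNorm_two_mul_self]
  have h2 := eLpNorm_two_szegoProj_trigPoly_le
    (trigPoly_mono (subset_univ _) (mul_mem_trigPoly (S := {k : Fin n → ℤ | ∀ j, 0 ≤ k j})
      (fun k hk l hl j => add_nonneg (hk j) (hl j)) hh hh)) r
  rw [szegoProj_mul_of_mem_trigPoly hh hh] at h2
  exact h2

end TrigonometricPolynomials

/-! ### The Szegő projection on `L^q` -/

section SzegoLp

variable {n : ℕ}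

theorem szegoProj_lp_add {q : ℝ≥0∞} [Fact (1 ≤ q)] (g h : Lp ℂ q (torusMeasure n)) :
    szegoProj (g + h : Lp ℂ q (torusMeasure n)) = szegoProj g + szegoProj h := by
  rw [szegoProj_congr_ae (Lp.coeFn_add g h),
    szegoProj_add ((Lp.memLp g).integrable Fact.out) ((Lp.memLp h).integrable Fact.out)]

theorem szegoProj_lp_smul {q : ℝ≥0∞} (c : ℂ) (g : Lp ℂ q (torusMeasure n)) :
    szegoProj (c • g : Lp ℂ q (torusMeasure n)) = c • szegoProj g := by
  rw [szegoProj_congr_ae (Lp.coeFn_smul c g), szegoProj_smul]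

theorem norm_szegoProj_lp_le {q : ℝ≥0∞} [Fact (1 ≤ q)] (g : Lp ℂ q (torusMeasure n))
    (z : openPolydisc n) : ‖szegoProj g z‖ ≤ ‖szegoKernel z.1‖ * ‖g‖ := by
  refine (norm_integral_continuousMap_mul_le _ ((Lp.memLp g).integrable Fact.out)).trans
    (mul_le_mul_of_nonneg_left ?_ (norm_nonneg _))
  rw [integral_norm_eq_lintegral_enorm (Lp.aestronglyMeasurable g), ← eLpNorm_one_eq_lintegral_enorm,
    Lp.norm_def]
  exact ENNReal.toReal_mono (Lp.memLp g).eLpNorm_lt_top.ne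
    (eLpNorm_le_eLpNorm_of_exponent_le Fact.out (Lp.aestronglyMeasurable g))

/-- Evaluation of the Szegő projection at a point, as a continuous functional on `L^q`. -/
def szegoEval (q : ℝ≥0∞) [Fact (1 ≤ q)] (z : openPolydisc n) : Lp ℂ q (torusMeasure n) →L[ℂ] ℂ :=
  LinearMap.mkContinuous
    { toFun := fun g => szegoProj g z
      map_add' := fun g h => congrFun (szegoProj_lp_add g h) z
      map_smul' := fun c g => congrFun (szegoProj_lp_smul c g) z }
    ‖szegoKernel z.1‖ fun g => norm_szegoProj_lp_le g z

/-- The Szegő projection has norm at most `C` from the trigonometric polynomials of `L^q` to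
`H^q`. -/
def SzegoBound (n : ℕ) (q : ℝ≥0∞) (C : ℝ≥0) : Prop :=
  ∀ g ∈ trigPoly (n := n) univ, ∀ r : Ico (0 : ℝ) 1,
    eLpNorm (fun t => szegoProj g (dilatedTorusPoint r t)) q (torusMeasure n)
      ≤ C * eLpNorm g q (torusMeasure n)

theorem szegoBound_two (n : ℕ) : SzegoBound n 2 1 := fun g hg r => by
  simpa using eLpNorm_two_szegoProj_trigPoly_le hg r

theorem szegoBound_four (n : ℕ) : SzegoBound n 4 (2 ^ n) := fun g hg r => by
  simpa using eLpNorm_four_szegoProj_trigPoly_le hg r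

/-- Trigonometric polynomials are dense in `L^q` and evaluation of the projection at a point is
continuous on `L^q`, so Fatou's lemma on each torus of radius `r` extends the bound. -/
theorem SzegoBound.hardyNorm_szegoProj_le {q : ℝ≥0∞} [Fact (1 ≤ q)] (hq : q ≠ ∞) {C : ℝ≥0}
    (hC : SzegoBound n q C) (g : Lp ℂ q (torusMeasure n)) :
    hardyNorm q (szegoProj g) ≤ C * eLpNorm g q (torusMeasure n) := by
  refine iSup_le fun r => ?_
  have hd := (ContinuousMap.toLp_denseRange ℂ (torusMeasure n) ℂ hq).topologicalClosure_map_submodule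
      (span_mFourier_closure_eq_top (d := Fin n))
  have hg : g ∈ closure (Submodule.map
      (ContinuousMap.toLp (E := ℂ) q (torusMeasure n) ℂ).toLinearMap (trigPoly univ) :
        Set (Lp ℂ q (torusMeasure n))) := by
    have h1 : g ∈ (⊤ : Submodule ℂ (Lp ℂ q (torusMeasure n))) := trivial
    rw [← hd, ← image_univ] at h1
    exact h1
  obtain ⟨u, hu, hlim⟩ := mem_closure_iff_seq_limit.1 hg
  choose G hG hGu using hu
  have hGu' : ∀ m, u m =ᵐ[torusMeasure n] G m := fun m => by
    rw [← hGu m]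
    exact ContinuousMap.coeFn_toLp _ _
  have h2 : ∀ m, eLpNorm (fun t => szegoProj (u m) (dilatedTorusPoint r t)) q (torusMeasure n)
      ≤ C * eLpNorm (u m) q (torusMeasure n) := by
    intro m
    rw [szegoProj_congr_ae (hGu' m), eLpNorm_congr_ae (hGu' m)]
    exact hC _ (hG m) r
  have hmeas : ∀ m, AEStronglyMeasurable (fun t => szegoProj (u m) (dilatedTorusPoint r t))
      (torusMeasure n) := fun m =>
    (isHolomorphicOnPolydisc_szegoProj ((Lp.memLp (u m)).integrable Fact.out)).aestronglyMeasurable r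
  refine (Lp.eLpNorm_lim_le_liminf_eLpNorm hmeas
    (fun t => szegoProj g (dilatedTorusPoint r t)) (.of_forall fun t => ?_)).trans ?_
  · exact ((szegoEval q (dilatedTorusPoint r t)).continuous.tendsto g).comp hlim
  · refine (liminf_le_liminf (.of_forall h2)).trans ?_
    have h3 : Tendsto (fun m => (C : ℝ≥0∞) * eLpNorm (u m) q (torusMeasure n)) atTop
        (𝓝 (C * eLpNorm g q (torusMeasure n))) := by
      refine ENNReal.Tendsto.const_mul ?_ (Or.inr ENNReal.coe_ne_top)
      have h4 := (continuous_enorm.tendsto g).comp hlim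
      simpa only [Lp.enorm_def, Function.comp_def] using h4
    exact h3.liminf_eq.le

/-- The Szegő projection from `L^q` to `H^q`. -/
def SzegoBound.toHardy {q : ℝ≥0∞} [Fact (1 ≤ q)] (hq : q ≠ ∞) {C : ℝ≥0} (hC : SzegoBound n q C) :
    Lp ℂ q (torusMeasure n) →L[ℂ] Hardy n q :=
  LinearMap.mkContinuous
    { toFun := fun g => (⟨szegoProj g,
        isHolomorphicOnPolydisc_szegoProj ((Lp.memLp g).integrable Fact.out),
        (hC.hardyNorm_szegoProj_le hq g).trans_lt
          (ENNReal.mul_lt_top ENNReal.coe_lt_top (Lp.memLp g).eLpNorm_lt_top)⟩ : hardySpace n q)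
      map_add' := fun g h => Subtype.ext (szegoProj_lp_add g h)
      map_smul' := fun c g => Subtype.ext (szegoProj_lp_smul c g) } C fun g => by
    rw [Hardy.norm_def, Lp.norm_def, ← ENNReal.coe_toReal, ← ENNReal.toReal_mul]
    exact ENNReal.toReal_mono
      (ENNReal.mul_lt_top ENNReal.coe_lt_top (Lp.memLp g).eLpNorm_lt_top).ne
      (hC.hardyNorm_szegoProj_le hq g)

theorem SzegoBound.incl_toHardy {q : ℝ≥0∞} [Fact (1 ≤ q)] (hq : q ≠ ∞) {C : ℝ≥0}
    (hC : SzegoBound n q C) (g : Lp ℂ q (torusMeasure n)) :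
    Hardy.incl n q (hC.toHardy hq g) = szegoProj g := rfl

theorem SzegoBound.norm_toHardy_le {q : ℝ≥0∞} [Fact (1 ≤ q)] (hq : q ≠ ∞) {C : ℝ≥0}
    (hC : SzegoBound n q C) (g : Lp ℂ q (torusMeasure n)) : ‖hC.toHardy hq g‖ ≤ C * ‖g‖ :=
  (hC.toHardy hq).le_of_opNorm_le (LinearMap.mkContinuous_norm_le _ C.2 _) g

end SzegoLp

/-! ### Complex powers as holomorphic functions with values in `L^q` -/

section LpPowers

variable {α : Type*} [MeasurableSpace α] {μ : Measure α}

theorem tendsto_eLpNorm_sub_of_dominated {ι : Type*} {l : Filter ι} [l.IsCountablyGenerated]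
    {q : ℝ≥0∞} (hq0 : q ≠ 0) (hq : q ≠ ∞) {F : ι → α → ℂ} {f : α → ℂ} {B : α → ℝ}
    (hF : ∀ᶠ i in l, AEStronglyMeasurable (F i) μ) (hf : AEStronglyMeasurable f μ)
    (hFB : ∀ᶠ i in l, ∀ t, ‖F i t‖ ≤ B t) (hfB : ∀ t, ‖f t‖ ≤ B t) (hB : MemLp B q μ)
    (hlim : ∀ t, Tendsto (fun i => F i t) l (𝓝 (f t))) :
    Tendsto (fun i => eLpNorm (F i - f) q μ) l (𝓝 0) := by
  have hq' : 0 < q.toReal := ENNReal.toReal_pos hq0 hq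
  have hB2 : MemLp (fun t => B t + B t) q μ := hB.add hB
  have h1 : Tendsto (fun i => ∫⁻ t, ‖(F i - f) t‖ₑ ^ q.toReal ∂μ) l (𝓝 (∫⁻ _, 0 ∂μ)) := by
    have hb : ∀ᶠ i in l, ∀ᵐ t ∂μ, ‖(F i - f) t‖ₑ ^ q.toReal ≤ ‖B t + B t‖ₑ ^ q.toReal := by
      filter_upwards [hFB] with i hi
      refine .of_forall fun t => ENNReal.rpow_le_rpow ?_ hq'.le
      refine enorm_le_iff_norm_le.2 ?_
      refine (norm_sub_le _ _).trans ((add_le_add (hi t) (hfB t)).trans (le_abs_self _))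
    refine tendsto_lintegral_filter_of_dominated_convergence' _ ?_ hb ?_ ?_
    · filter_upwards [hF] with i hi
      exact (hi.sub hf).enorm.pow_const _
    · exact (lintegral_rpow_enorm_lt_top_of_eLpNorm_lt_top hq0 hq hB2.eLpNorm_lt_top).ne
    · refine .of_forall fun t => ?_
      have h2 : Tendsto (fun i => (F i - f) t) l (𝓝 0) := by
        simpa using (hlim t).sub_const (f t)
      have h3 := (ENNReal.continuous_rpow_const (y := q.toReal)).tendsto _ |>.comp
        ((continuous_enorm.tendsto _).comp h2)
      simpa [hq', Function.comp_def] using h3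
  simp only [lintegral_zero] at h1
  have h2 := (ENNReal.continuous_rpow_const (y := 1 / q.toReal)).tendsto _ |>.comp h1
  rw [ENNReal.zero_rpow_of_pos (by positivity)] at h2
  refine h2.congr fun i => ?_
  rw [eLpNorm_eq_lintegral_rpow_enorm_toReal hq0 hq]
  rfl

theorem rpow_le_rpow_add_rpow {w : ℝ} (hw : 0 ≤ w) {a b x : ℝ} (ha : 0 < a) (hx : x ∈ Icc a b) :
    w ^ x ≤ w ^ a + w ^ b := by
  rcases le_total w 1 with h | h
  · exact (Real.rpow_le_rpow_of_exponent_ge_of_imp hw h hx.1 (fun _ h0 => absurd h0 (ha.trans_le hx.1).ne')).trans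
      (le_add_of_nonneg_right (by positivity))
  · exact (Real.rpow_le_rpow_of_exponent_le h hx.2).trans (le_add_of_nonneg_left (by positivity))

/-- The logarithm is absorbed by shifting the exponent by `ε`, towards `a` when `w ≤ 1` and towards
`b` otherwise. This bounds the derivative of `s ↦ w^s` uniformly in `w`. -/
theorem abs_log_mul_rpow_le {w : ℝ} (hw : 0 < w) {a b x ε : ℝ} (ha : 0 < a) (hε : 0 < ε)
    (hx : x ∈ Icc (a + ε) (b - ε)) : |Real.log w| * w ^ x ≤ ε⁻¹ * (w ^ a + w ^ b) := by
  rcases le_total w 1 with h | h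
  · have h1 : |Real.log w| ≤ w⁻¹ ^ ε / ε := by
      rw [abs_of_nonpos (Real.log_nonpos hw.le h), ← Real.log_inv]
      exact Real.log_le_rpow_div (by positivity) hε
    calc |Real.log w| * w ^ x ≤ w⁻¹ ^ ε / ε * w ^ x :=
          mul_le_mul_of_nonneg_right h1 (by positivity)
      _ = ε⁻¹ * w ^ (x - ε) := by
          rw [Real.inv_rpow hw.le, Real.rpow_sub hw]; field_simp
      _ ≤ _ := mul_le_mul_of_nonneg_left
          (rpow_le_rpow_add_rpow hw.le ha ⟨by linarith [hx.1], by linarith [hx.2]⟩) (by positivity)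
  · have h1 : |Real.log w| ≤ w ^ ε / ε := by
      rw [abs_of_nonneg (Real.log_nonneg h)]
      exact Real.log_le_rpow_div (by positivity) hε
    calc |Real.log w| * w ^ x ≤ w ^ ε / ε * w ^ x :=
          mul_le_mul_of_nonneg_right h1 (by positivity)
      _ = ε⁻¹ * w ^ (x + ε) := by
          rw [Real.rpow_add hw]; field_simp
      _ ≤ _ := mul_le_mul_of_nonneg_left
          (rpow_le_rpow_add_rpow hw.le ha ⟨by linarith [hx.1], by linarith [hx.2]⟩) (by positivity)

theorem norm_cpow_eq_rpow_re {w : ℝ} (hw : 0 ≤ w) {s : ℂ} (hs : 0 < s.re) :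
    ‖(w : ℂ) ^ s‖ = w ^ s.re :=
  Complex.norm_cpow_eq_rpow_re_of_nonneg hw hs.ne'

/-- Data for the family of functions `σ w^s`, `a ≤ Re s ≤ b`, to take its values in `L^q`. -/
structure PowerFamily (μ : Measure α) (q : ℝ≥0∞) (σ : α → ℂ) (w : α → ℝ) (a b : ℝ) : Prop where
  one_le : 1 ≤ q
  ne_top : q ≠ ∞
  aestronglyMeasurable : AEStronglyMeasurable σ μ
  norm_le : ∀ t, ‖σ t‖ ≤ 1
  aemeasurable : AEMeasurable w μ
  nonneg : ∀ t, 0 ≤ w t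
  pos : 0 < a
  left : MemLp (fun t => w t ^ a) q μ
  right : MemLp (fun t => w t ^ b) q μ

namespace PowerFamily

variable {q : ℝ≥0∞} {σ : α → ℂ} {w : α → ℝ} {a b : ℝ}

theorem bound (h : PowerFamily μ q σ w a b) : MemLp (fun t => w t ^ a + w t ^ b) q μ :=
  h.left.add h.right

theorem aestronglyMeasurable_cpow (h : PowerFamily μ q σ w a b) (s : ℂ) :
    AEStronglyMeasurable (fun t => σ t * (w t : ℂ) ^ s) μ :=
  h.aestronglyMeasurable.mul
    ((Complex.measurable_ofReal.comp_aemeasurable h.aemeasurable).pow_const s).aestronglyMeasurable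

theorem norm_mul_cpow_le (h : PowerFamily μ q σ w a b) {s : ℂ} (hs : s.re ∈ Icc a b) (t : α) :
    ‖σ t * (w t : ℂ) ^ s‖ ≤ w t ^ a + w t ^ b := by
  rw [norm_mul, norm_cpow_eq_rpow_re (h.nonneg t) (h.pos.trans_le hs.1)]
  refine (mul_le_of_le_one_left (Real.rpow_nonneg (h.nonneg t) _) (h.norm_le t)).trans ?_
  exact rpow_le_rpow_add_rpow (h.nonneg t) h.pos hs

theorem memLp (h : PowerFamily μ q σ w a b) {s : ℂ} (hs : s.re ∈ Icc a b) :
    MemLp (fun t => σ t * (w t : ℂ) ^ s) q μ :=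
  h.bound.mono (h.aestronglyMeasurable_cpow s) (.of_forall fun t =>
    (h.norm_mul_cpow_le hs t).trans (le_abs_self _))

open Classical in
/-- The function `σ w^s` as an element of `L^q` (zero if it is not in that space). -/
def _root_.powLp (μ : Measure α) (q : ℝ≥0∞) (σ : α → ℂ) (w : α → ℝ) (s : ℂ) : Lp ℂ q μ :=
  if h : MemLp (fun t => σ t * (w t : ℂ) ^ s) q μ then h.toLp else 0

theorem powLp_eq (h : PowerFamily μ q σ w a b) {s : ℂ} (hs : s.re ∈ Icc a b) :
    powLp μ q σ w s = (h.memLp hs).toLp := dif_pos (h.memLp hs)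

theorem coeFn_powLp (h : PowerFamily μ q σ w a b) {s : ℂ} (hs : s.re ∈ Icc a b) :
    powLp μ q σ w s =ᵐ[μ] fun t => σ t * (w t : ℂ) ^ s := by
  rw [h.powLp_eq hs]
  exact MemLp.coeFn_toLp _

theorem norm_powLp_le (h : PowerFamily μ q σ w a b) {s : ℂ} (hs : s.re ∈ Icc a b) :
    ‖powLp μ q σ w s‖ ≤ (eLpNorm (fun t => w t ^ a + w t ^ b) q μ).toReal := by
  rw [h.powLp_eq hs, Lp.norm_toLp]
  exact ENNReal.toReal_mono h.bound.eLpNorm_lt_top.ne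
    (eLpNorm_mono_real (h.norm_mul_cpow_le hs))

theorem continuousOn_powLp [Fact (1 ≤ q)] (h : PowerFamily μ q σ w a b) :
    ContinuousOn (powLp μ q σ w) (Complex.re ⁻¹' Icc a b) := by
  intro s₀ hs₀
  have hS : ∀ᶠ s in 𝓝[Complex.re ⁻¹' Icc a b] s₀, s ∈ Complex.re ⁻¹' Icc a b :=
    self_mem_nhdsWithin
  rw [ContinuousWithinAt, Lp.tendsto_Lp_iff_tendsto_eLpNorm']
  refine (tendsto_eLpNorm_sub_of_dominated (zero_lt_one.trans_le h.one_le).ne' h.ne_top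
    (F := fun s t => σ t * (w t : ℂ) ^ s) (f := fun t => σ t * (w t : ℂ) ^ s₀)
    (l := 𝓝[Complex.re ⁻¹' Icc a b] s₀) (.of_forall h.aestronglyMeasurable_cpow)
    (h.aestronglyMeasurable_cpow s₀) (hS.mono fun s hs => h.norm_mul_cpow_le hs)
    (h.norm_mul_cpow_le hs₀) h.bound fun t => ?_).congr' ?_
  · have hs0 : s₀ ≠ 0 := fun h0 => (h.pos.trans_le hs₀.1).ne' (by simp [h0])
    exact tendsto_const_nhds.mul
      ((hasDerivAt_id s₀).const_cpow (Or.inr hs0)).continuousAt.continuousWithinAt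
  · filter_upwards [hS] with s hs
    exact (eLpNorm_congr_ae ((h.coeFn_powLp hs).sub (h.coeFn_powLp hs₀))).symm

/-- Mean value inequality on the ball. The margin `2 * ε` around `s₀` leaves a margin `ε` around
every point of the ball, as the bound on the logarithm requires. -/
theorem norm_cpow_sub_cpow_le {w : ℝ} (hw : 0 ≤ w) (ha : 0 < a) {s₀ s : ℂ} {ε : ℝ} (hε : 0 < ε)
    (hs₀ : s₀.re ∈ Icc (a + 2 * ε) (b - 2 * ε)) (hs : s ∈ Metric.ball s₀ ε) :
    ‖(w : ℂ) ^ s - (w : ℂ) ^ s₀‖ ≤ ε⁻¹ * (w ^ a + w ^ b) * ‖s - s₀‖ := by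
  have hre : ∀ u ∈ Metric.ball s₀ ε, u.re ∈ Icc (a + ε) (b - ε) := by
    intro u hu
    have h1 := (Complex.abs_re_le_norm (u - s₀)).trans_lt (mem_ball_iff_norm.1 hu)
    rw [Complex.sub_re, abs_lt] at h1
    constructor <;> linarith [hs₀.1, hs₀.2]
  have hne : ∀ u ∈ Metric.ball s₀ ε, u ≠ 0 := by
    rintro u hu rfl
    have := (hre 0 hu).1
    simp only [Complex.zero_re] at this
    linarith
  refine (convex_ball s₀ ε).norm_image_sub_le_of_norm_hasDerivWithin_le
    (f := fun u => (w : ℂ) ^ u) (f' := fun u => (w : ℂ) ^ u * Complex.log w)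
    (fun u hu => ?_) (fun u hu => ?_) (Metric.mem_ball_self hε) hs
  · simpa using ((hasDerivAt_id u).const_cpow (c := (w : ℂ)) (Or.inr (hne u hu))).hasDerivWithinAt
  -- At `w = 0` the derivative is `0` because `Complex.log 0 = 0`, in agreement with `0 ^ u = 0` for
  -- `u ≠ 0`.
  · rcases hw.eq_or_lt with rfl | hw
    · simp only [Complex.ofReal_zero, Complex.log_zero, mul_zero, norm_zero]
      have hb : (0 : ℝ) ≤ 0 ^ b := Real.rpow_nonneg le_rfl b
      have ha : (0 : ℝ) ≤ 0 ^ a := Real.rpow_nonneg le_rfl a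
      positivity
    · have hu' := hre u hu
      rw [norm_mul, norm_cpow_eq_rpow_re hw.le (by linarith [hu'.1]), ← Complex.ofReal_log hw.le,
        Complex.norm_real, mul_comm]
      exact abs_log_mul_rpow_le hw ha hε hu'

theorem differentiableOn_powLp [Fact (1 ≤ q)] (h : PowerFamily μ q σ w a b) :
    DifferentiableOn ℂ (powLp μ q σ w) (Complex.re ⁻¹' Ioo a b) := by
  intro s₀ hs₀
  refine DifferentiableAt.differentiableWithinAt ?_
  obtain ⟨ε, hε, hε₀⟩ : ∃ ε : ℝ, 0 < ε ∧ s₀.re ∈ Icc (a + 2 * ε) (b - 2 * ε) := by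
    have h1 := hs₀.1
    have h2 := hs₀.2
    refine ⟨min (s₀.re - a) (b - s₀.re) / 2, ?_, ?_, ?_⟩
    · exact half_pos (lt_min (sub_pos.2 h1) (sub_pos.2 h2))
    · linarith [min_le_left (s₀.re - a) (b - s₀.re)]
    · linarith [min_le_right (s₀.re - a) (b - s₀.re)]
  have hs₀' : s₀.re ∈ Icc a b := ⟨hs₀.1.le, hs₀.2.le⟩
  have hball : ∀ s ∈ Metric.ball s₀ ε, s.re ∈ Icc a b := by
    intro s hs
    have h1 := (Complex.abs_re_le_norm (s - s₀)).trans_lt (mem_ball_iff_norm.1 hs)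
    rw [Complex.sub_re, abs_lt] at h1
    constructor <;> linarith [hε₀.1, hε₀.2]
  have hs0 : s₀ ≠ 0 := by
    rintro rfl
    have := hs₀'.1
    simp only [Complex.zero_re] at this
    linarith [h.pos]
  let B : α → ℝ := fun t => ε⁻¹ * (w t ^ a + w t ^ b)
  have hB : MemLp B q μ := h.bound.const_mul _
  -- The difference quotients `F s` converge pointwise to `D` and are dominated by `B` in `L^q`, so
  -- they converge in `L^q`.
  let F : ℂ → α → ℂ := fun s t => (s - s₀)⁻¹ * (σ t * (w t : ℂ) ^ s - σ t * (w t : ℂ) ^ s₀)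
  let D : α → ℂ := fun t => σ t * ((w t : ℂ) ^ s₀ * Complex.log (w t))
  have hlim : ∀ t, Tendsto (fun s => F s t) (𝓝[≠] s₀) (𝓝 (D t)) := by
    intro t
    have h1 : HasDerivAt (fun s : ℂ => σ t * (w t : ℂ) ^ s) (D t) s₀ := by
      simpa using ((hasDerivAt_id s₀).const_cpow (c := (w t : ℂ)) (Or.inr hs0)).const_mul (σ t)
    exact (hasDerivAt_iff_tendsto_slope.1 h1).congr fun s => by
      simp [slope_def_field, F, div_eq_inv_mul]
  have hFB : ∀ s ∈ Metric.ball s₀ ε, ∀ t, ‖F s t‖ ≤ B t := by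
    intro s hs t
    have h1 := norm_cpow_sub_cpow_le (h.nonneg t) h.pos hε hε₀ hs
    have hBt : 0 ≤ B t := by
      have ha := Real.rpow_nonneg (h.nonneg t) a
      have hb := Real.rpow_nonneg (h.nonneg t) b
      positivity
    rcases eq_or_ne s s₀ with rfl | hne
    · simpa [F] using hBt
    · have hpos : 0 < ‖s - s₀‖ := norm_pos_iff.2 (sub_ne_zero.2 hne)
      simp only [F]
      rw [← mul_sub, norm_mul, norm_mul, norm_inv, inv_mul_le_iff₀ hpos, mul_comm ‖s - s₀‖]
      exact (mul_le_of_le_one_left (norm_nonneg _) (h.norm_le t)).trans h1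
  have hnhds : ∀ᶠ s in 𝓝[≠] s₀, s ∈ Metric.ball s₀ ε :=
    mem_nhdsWithin_of_mem_nhds (Metric.ball_mem_nhds s₀ hε)
  have hDB : ∀ t, ‖D t‖ ≤ B t := fun t =>
    le_of_tendsto (hlim t).norm (hnhds.mono fun s hs => hFB s hs t)
  have hFm : ∀ s, AEStronglyMeasurable (F s) μ := fun s =>
    ((h.aestronglyMeasurable_cpow s).sub (h.aestronglyMeasurable_cpow s₀)).const_mul _
  have hDm : AEStronglyMeasurable D μ :=
    h.aestronglyMeasurable.mul
      (((Complex.measurable_ofReal.comp_aemeasurable h.aemeasurable).pow_const s₀).mul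
        (Complex.measurable_log.comp_aemeasurable
          (Complex.measurable_ofReal.comp_aemeasurable h.aemeasurable))).aestronglyMeasurable
  have hD : MemLp D q μ := hB.mono hDm (.of_forall fun t => (hDB t).trans (le_abs_self _))
  have hderiv : HasDerivAt (powLp μ q σ w) hD.toLp s₀ := by
    rw [hasDerivAt_iff_tendsto_slope, Lp.tendsto_Lp_iff_tendsto_eLpNorm']
    refine (tendsto_eLpNorm_sub_of_dominated (zero_lt_one.trans_le h.one_le).ne' h.ne_top
      (.of_forall hFm) hDm (hnhds.mono hFB) hDB hB hlim).congr' ?_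
    filter_upwards [hnhds] with s hs
    refine (eLpNorm_congr_ae ?_).symm
    refine EventuallyEq.sub ?_ hD.coeFn_toLp
    rw [slope_def_module]
    filter_upwards [Lp.coeFn_smul (s - s₀)⁻¹ (powLp μ q σ w s - powLp μ q σ w s₀),
      Lp.coeFn_sub (powLp μ q σ w s) (powLp μ q σ w s₀), h.coeFn_powLp (hball s hs),
      h.coeFn_powLp hs₀'] with t h1 h2 h3 h4
    rw [h1, Pi.smul_apply, h2, Pi.sub_apply, h3, h4, smul_eq_mul]
  exact hderiv.differentiableAt

end PowerFamily

end LpPowers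

/-! ### Boundary functions -/

section BoundaryFunction

/-- Banach–Alaoglu through the Riesz isomorphism. An ultrafilter replaces a subsequence, so
separability plays no role; conjugations appear because the isomorphism is conjugate-linear. -/
theorem exists_forall_strongDual_tendsto {E : Type*} [NormedAddCommGroup E] [InnerProductSpace ℂ E]
    [CompleteSpace E] {u : ℕ → E} {M : ℝ} (hu : ∀ m, ‖u m‖ ≤ M) :
    ∃ (U : Ultrafilter ℕ) (g : E), (U : Filter ℕ) ≤ atTop ∧
      ∀ L : StrongDual ℂ E, Tendsto (fun m => L (u m)) U (𝓝 (L g)) := by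
  let U : Ultrafilter ℕ := hyperfilter ℕ
  have hU : (U : Filter ℕ) ≤ atTop := by
    rw [← Nat.cofinite_eq_atTop]; exact hyperfilter_le_cofinite
  let d : ℕ → WeakDual ℂ E := fun m =>
    StrongDual.toWeakDual (InnerProductSpace.toDual ℂ E (u m))
  have hd : ∀ m, d m ∈ WeakDual.toStrongDual ⁻¹' Metric.closedBall (0 : StrongDual ℂ E) M := by
    intro m
    rw [mem_preimage, mem_closedBall_zero_iff]
    exact ((InnerProductSpace.toDual ℂ E).norm_map (u m)).le.trans (hu m)
  obtain ⟨φ, -, hφ⟩ := (WeakDual.isCompact_closedBall (0 : StrongDual ℂ E) M).ultrafilter_le_nhds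
    (U.map d) (by
      rw [le_principal_iff]
      exact Filter.mem_map.2 (Filter.univ_mem' hd))
  refine ⟨U, (InnerProductSpace.toDual ℂ E).symm (WeakDual.toStrongDual φ), hU, fun L => ?_⟩
  set v := (InnerProductSpace.toDual ℂ E).symm L
  have hL : ∀ x, L x = inner ℂ v x := fun x => (InnerProductSpace.toDual_symm_apply).symm
  have h1 : Tendsto (fun m => d m v) U (𝓝 (φ v)) :=
    ((WeakDual.eval_continuous v).tendsto φ).comp hφ
  have h2 := (Complex.continuous_conj.tendsto _).comp h1
  have h3 : conj (φ v) = L ((InnerProductSpace.toDual ℂ E).symm (WeakDual.toStrongDual φ)) := by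
    rw [hL, ← inner_conj_symm, InnerProductSpace.toDual_symm_apply]
    rfl
  rw [h3] at h2
  refine h2.congr fun m => ?_
  rw [hL, ← inner_conj_symm]
  rfl

variable {α : Type*} [MeasurableSpace α] {μ : Measure α}

/-- Convexity, together with the closedness proved next, lets Hahn–Banach show that an `L^p` ball is
weakly closed in `L²`. -/
theorem convex_setOf_eLpNorm_le {p : ℝ≥0∞} (hp : 1 ≤ p) (M : ℝ≥0∞) :
    Convex ℝ {h : Lp ℂ 2 μ | eLpNorm h p μ ≤ M} := by
  intro x hx y hy a b ha hb hab
  have h1 : (a • x + b • y : Lp ℂ 2 μ) =ᵐ[μ] a • ⇑x + b • ⇑y :=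
    (Lp.coeFn_add _ _).trans ((Lp.coeFn_smul a x).add (Lp.coeFn_smul b y))
  change eLpNorm _ p μ ≤ M
  rw [eLpNorm_congr_ae h1]
  refine (eLpNorm_add_le ((Lp.aestronglyMeasurable x).const_smul a)
    ((Lp.aestronglyMeasurable y).const_smul b) hp).trans ?_
  rw [eLpNorm_const_smul, eLpNorm_const_smul, Real.enorm_of_nonneg ha, Real.enorm_of_nonneg hb]
  calc _ ≤ ENNReal.ofReal a * M + ENNReal.ofReal b * M := add_le_add (by gcongr; exact hx)
        (by gcongr; exact hy)
    _ = M := by rw [← add_mul, ← ENNReal.ofReal_add ha hb, hab, ENNReal.ofReal_one, one_mul]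

theorem isClosed_setOf_eLpNorm_le (p M : ℝ≥0∞) :
    IsClosed {h : Lp ℂ 2 μ | eLpNorm h p μ ≤ M} := by
  refine IsSeqClosed.isClosed fun x y hx hxy => ?_
  obtain ⟨k, -, hk⟩ := (tendstoInMeasure_of_tendsto_Lp hxy).exists_seq_tendsto_ae
  exact Lp.eLpNorm_le_of_ae_tendsto (u := atTop) (f := fun m => x (k m))
    (.of_forall fun m => hx (k m)) (fun m => Lp.aestronglyMeasurable _) hk

/-- Weak lower semicontinuity of the `L^p` norm on `L²`. -/
theorem eLpNorm_le_of_weak_limit {p M : ℝ≥0∞} (hp : 1 ≤ p) {U : Filter ℕ} [U.NeBot]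
    {u : ℕ → Lp ℂ 2 μ} {g : Lp ℂ 2 μ} (hu : ∀ m, eLpNorm (u m) p μ ≤ M)
    (hg : ∀ L : StrongDual ℂ (Lp ℂ 2 μ), Tendsto (fun m => L (u m)) U (𝓝 (L g))) :
    eLpNorm g p μ ≤ M := by
  by_contra hgM
  obtain ⟨L, c, hL, hLg⟩ := RCLike.geometric_hahn_banach_closed_point (𝕜 := ℂ)
    (convex_setOf_eLpNorm_le hp M) (isClosed_setOf_eLpNorm_le (μ := μ) p M) hgM
  have h1 := (Complex.continuous_re.tendsto _).comp (hg L)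
  exact hLg.not_ge (le_of_tendsto h1 (.of_forall fun m => (hL (u m) (hu m)).le))

variable {n : ℕ}

theorem IsHolomorphicOnPolydisc.memLp_dilate {f : openPolydisc n → ℂ}
    (hf : IsHolomorphicOnPolydisc f) (r : Ico (0 : ℝ) 1) (p : ℝ≥0∞) :
    MemLp (fun t => f (dilatedTorusPoint r t)) p (torusMeasure n) := by
  let F : C(UnitAddTorus (Fin n), ℂ) := ⟨_, hf.continuous_dilate r⟩
  exact ⟨hf.aestronglyMeasurable r, eLpNorm_continuousMap_lt_top p F⟩

theorem eLpNorm_dilate_le_hardyNorm (p : ℝ≥0∞) (f : openPolydisc n → ℂ) (r : Ico (0 : ℝ) 1) :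
    eLpNorm (fun t => f (dilatedTorusPoint r t)) p (torusMeasure n) ≤ hardyNorm p f :=
  le_iSup (fun r : Ico (0 : ℝ) 1 =>
    eLpNorm (fun t => f (dilatedTorusPoint r t)) p (torusMeasure n)) r

/-- A function in `H^p`, `p ≥ 2`, is the Szegő projection of a function in `L^p` of no larger
norm. -/
theorem exists_szegoProj_eq {p : ℝ≥0∞} (hp : 2 ≤ p) {f : openPolydisc n → ℂ}
    (hf : f ∈ hardySpace n p) : ∃ g : Lp ℂ 2 (torusMeasure n),
      eLpNorm g p (torusMeasure n) ≤ hardyNorm p f ∧ szegoProj g = f := by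
  let ρ : ℕ → Ico (0 : ℝ) 1 := fun m => ⟨1 - 1 / ((m : ℝ) + 1), by
    rw [sub_nonneg, div_le_one (by positivity)]
    linarith [(Nat.cast_nonneg m : (0 : ℝ) ≤ m)], by
    have : (0 : ℝ) < 1 / ((m : ℝ) + 1) := by positivity
    linarith⟩
  have hρ : Tendsto (fun m => (ρ m : ℝ)) atTop (𝓝 1) := by
    simpa [ρ] using (tendsto_one_div_add_atTop_nhds_zero_nat (𝕜 := ℝ)).const_sub (1 : ℝ)
  let u : ℕ → Lp ℂ 2 (torusMeasure n) := fun m => (hf.1.memLp_dilate (ρ m) 2).toLp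
  have hcoe : ∀ m, u m =ᵐ[torusMeasure n] fun t => f (dilatedTorusPoint (ρ m) t) := fun m =>
    MemLp.coeFn_toLp _
  have hup : ∀ m, eLpNorm (u m) p (torusMeasure n) ≤ hardyNorm p f := fun m => by
    rw [eLpNorm_congr_ae (hcoe m)]
    exact eLpNorm_dilate_le_hardyNorm p f (ρ m)
  have hu2 : ∀ m, ‖u m‖ ≤ (hardyNorm p f).toReal := fun m => by
    rw [Lp.norm_def]
    exact ENNReal.toReal_mono hf.2.ne
      ((eLpNorm_le_eLpNorm_of_exponent_le hp (Lp.aestronglyMeasurable _)).trans (hup m))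
  obtain ⟨U, g, hU, hg⟩ := exists_forall_strongDual_tendsto hu2
  refine ⟨g, eLpNorm_le_of_weak_limit (one_le_two.trans hp) hup hg, funext fun z => ?_⟩
  -- Testing the weak convergence on the Szegő functional at `z` identifies the limit: by Cauchy's
  -- formula its value at `u m` is `f (ρ_m z)`, which tends to `f z`.
  have h1 := hg (szegoEval 2 z)
  let y : ℕ → openPolydisc n := fun m => ⟨fun j => (ρ m : ℝ) * z.1 j, fun j => by
    rw [norm_mul, Complex.norm_of_nonneg (ρ m).2.1]
    exact (mul_le_of_le_one_left (norm_nonneg _) (ρ m).2.2.le).trans_lt (z.2 j)⟩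
  have h2 : ∀ m, szegoEval 2 z (u m) = f (y m) := fun m => by
    change szegoProj (u m) z = _
    rw [szegoProj_congr_ae (hcoe m)]
    exact szegoProj_dilate hf.1 (ρ m) z (y m) fun j => rfl
  have h3 : Tendsto y atTop (𝓝 z) := by
    rw [tendsto_subtype_rng, tendsto_pi_nhds]
    intro j
    have h4 := ((Complex.continuous_ofReal.tendsto 1).comp hρ).mul_const (z.1 j)
    simpa using h4
  have h5 : Tendsto (fun m => szegoEval 2 z (u m)) U (𝓝 (f z)) := by
    simp only [h2]
    exact ((hf.1.continuous.tendsto z).comp h3).mono_left hU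
  exact tendsto_nhds_unique h1 h5

end BoundaryFunction

/-! ### The couple `(H², H⁴)` -/

section Couple

variable {n : ℕ}

/-- Restriction of a function of `H^q` to the torus of radius `r`, as an element of `L²`. -/
def dilateLp (q : ℝ≥0∞) [Fact (1 ≤ q)] (hq : 2 ≤ q) (r : Ico (0 : ℝ) 1) :
    Hardy n q →L[ℂ] Lp ℂ 2 (torusMeasure n) :=
  LinearMap.mkContinuous
    { toFun := fun f => ((Hardy.incl_mem f).1.memLp_dilate r 2).toLp
      map_add' := fun f g => rfl
      map_smul' := fun c f => rfl } 1 fun f => by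
    rw [one_mul, Hardy.norm_def]
    refine (Lp.norm_toLp _ ((Hardy.incl_mem f).1.memLp_dilate r 2)).le.trans
      (ENNReal.toReal_mono (Hardy.incl_mem f).2.ne ?_)
    exact (eLpNorm_le_eLpNorm_of_exponent_le hq ((Hardy.incl_mem f).1.aestronglyMeasurable r)).trans
      (eLpNorm_dilate_le_hardyNorm q _ r)

theorem coeFn_dilateLp {q : ℝ≥0∞} [Fact (1 ≤ q)] (hq : 2 ≤ q) (r : Ico (0 : ℝ) 1) (f : Hardy n q) :
    dilateLp q hq r f =ᵐ[torusMeasure n] fun t => Hardy.incl n q f (dilatedTorusPoint r t) :=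
  MemLp.coeFn_toLp ((Hardy.incl_mem f).1.memLp_dilate r 2)

theorem two_le_four_ennreal : (2 : ℝ≥0∞) ≤ 4 := by norm_num

/-- The map `(f, g) ↦ f + g` from `H² × H⁴`, followed by restriction to the torus of radius `r`. -/
def dilateProd (n : ℕ) (r : Ico (0 : ℝ) 1) : Hardy n 2 × Hardy n 4 →L[ℂ] Lp ℂ 2 (torusMeasure n) :=
  (dilateLp 2 le_rfl r).coprod (dilateLp 4 two_le_four_ennreal r)

theorem coeFn_dilateProd (r : Ico (0 : ℝ) 1) (x : Hardy n 2 × Hardy n 4) :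
    dilateProd n r x =ᵐ[torusMeasure n] fun t =>
      (Hardy.incl n 2).coprod (Hardy.incl n 4) x (dilatedTorusPoint r t) := by
  change (dilateLp 2 le_rfl r x.1 + dilateLp 4 two_le_four_ennreal r x.2 :
    Lp ℂ 2 (torusMeasure n)) =ᵐ[_] _
  filter_upwards [Lp.coeFn_add (dilateLp 2 le_rfl r x.1) (dilateLp 4 two_le_four_ennreal r x.2),
    coeFn_dilateLp le_rfl r x.1, coeFn_dilateLp two_le_four_ennreal r x.2] with t h1 h2 h3
  rw [h1, Pi.add_apply, h2, h3]
  rfl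

theorem isHolomorphicOnPolydisc_coprod_incl (x : Hardy n 2 × Hardy n 4) :
    IsHolomorphicOnPolydisc ((Hardy.incl n 2).coprod (Hardy.incl n 4) x) :=
  (Hardy.incl_mem x.1).1.add (Hardy.incl_mem x.2).1

/-- A holomorphic function vanishes iff all its restrictions to tori do, and these are continuous in
the pair. The kernel is therefore closed, and the quotient seminorm on `H² + H⁴` is a norm. -/
theorem ker_coprod_incl_eq (n : ℕ) :
    (LinearMap.ker ((Hardy.incl n 2).coprod (Hardy.incl n 4)) : Set (Hardy n 2 × Hardy n 4))
      = ⋂ r, {x | dilateProd n r x = 0} := by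
  ext x
  simp only [SetLike.mem_coe, LinearMap.mem_ker, mem_iInter]
  constructor
  · intro hx r
    refine Lp.ext ?_
    filter_upwards [coeFn_dilateProd r x, Lp.coeFn_zero ℂ 2 (torusMeasure n)] with t h1 h2
    rw [h1, h2, hx]
    rfl
  · intro hx
    refine (isHolomorphicOnPolydisc_coprod_incl x).eq_zero_of_hardyNorm_eq_zero (p := 2)
      two_ne_zero ?_
    refine le_antisymm (iSup_le fun r => ?_) bot_le
    rw [← eLpNorm_congr_ae (coeFn_dilateProd r x), show dilateProd n r x = 0 from hx r,
      eLpNorm_congr_ae (Lp.coeFn_zero ℂ 2 (torusMeasure n)), eLpNorm_zero]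

instance isClosed_ker_coprod_incl (n : ℕ) :
    IsClosed (LinearMap.ker ((Hardy.incl n 2).coprod (Hardy.incl n 4)) :
      Set (Hardy n 2 × Hardy n 4)) := by
  rw [ker_coprod_incl_eq]
  exact isClosed_iInter fun r => isClosed_eq (dilateProd n r).continuous continuous_const

/-- The sum `H² + H⁴`. -/
abbrev HardySum (n : ℕ) : Type := CoupleSum (Hardy.incl n 2) (Hardy.incl n 4)

/-- The embedding of `H²` in `H² + H⁴`. -/
def hardyInl (n : ℕ) : Hardy n 2 →L[ℂ] HardySum n :=
  LinearMap.mkContinuous (CoupleSum.inl (Hardy.incl n 2) (Hardy.incl n 4)) 1 fun x => by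
    rw [one_mul]
    exact (Submodule.Quotient.norm_mk_le _ _).trans (by simp [LinearMap.inl_apply, Prod.norm_def])

theorem toAmbient_mk (x : Hardy n 2 × Hardy n 4) :
    CoupleSum.toAmbient (Hardy.incl n 2) (Hardy.incl n 4) (Submodule.Quotient.mk x)
      = (Hardy.incl n 2).coprod (Hardy.incl n 4) x := rfl

theorem toAmbient_inl (x : Hardy n 2) :
    CoupleSum.toAmbient (Hardy.incl n 2) (Hardy.incl n 4)
      (CoupleSum.inl (Hardy.incl n 2) (Hardy.incl n 4) x) = Hardy.incl n 2 x := by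
  refine (toAmbient_mk (x, 0)).trans ?_
  simp

theorem toAmbient_inr (y : Hardy n 4) :
    CoupleSum.toAmbient (Hardy.incl n 2) (Hardy.incl n 4)
      (CoupleSum.inr (Hardy.incl n 2) (Hardy.incl n 4) y) = Hardy.incl n 4 y := by
  refine (toAmbient_mk (0, y)).trans ?_
  simp

theorem inl_eq_inr {x : Hardy n 2} {y : Hardy n 4} (h : Hardy.incl n 2 x = Hardy.incl n 4 y) :
    CoupleSum.inl (Hardy.incl n 2) (Hardy.incl n 4) x
      = CoupleSum.inr (Hardy.incl n 2) (Hardy.incl n 4) y := by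
  refine (Submodule.Quotient.eq _).2 ?_
  simp [LinearMap.mem_ker, h]

/-- Restriction of a function of `H² + H⁴` to the torus of radius `r`. -/
def dilateSum (n : ℕ) (r : Ico (0 : ℝ) 1) : HardySum n →L[ℂ] Lp ℂ 2 (torusMeasure n) where
  toLinearMap := (LinearMap.ker ((Hardy.incl n 2).coprod (Hardy.incl n 4))).liftQ
    (dilateProd n r).toLinearMap fun x hx => by
      have h : x ∈ (LinearMap.ker ((Hardy.incl n 2).coprod (Hardy.incl n 4)) :
        Set (Hardy n 2 × Hardy n 4)) := hx
      rw [ker_coprod_incl_eq] at h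
      exact mem_iInter.1 h r
  cont := (dilateProd n r).continuous.quotient_lift _

theorem coeFn_dilateSum (r : Ico (0 : ℝ) 1) (u : HardySum n) :
    dilateSum n r u =ᵐ[torusMeasure n] fun t =>
      CoupleSum.toAmbient (Hardy.incl n 2) (Hardy.incl n 4) u (dilatedTorusPoint r t) := by
  obtain ⟨x, rfl⟩ := Submodule.Quotient.mk_surjective _ u
  exact coeFn_dilateProd r x

theorem isHolomorphicOnPolydisc_toAmbient (u : HardySum n) :
    IsHolomorphicOnPolydisc (CoupleSum.toAmbient (Hardy.incl n 2) (Hardy.incl n 4) u) := by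
  obtain ⟨x, rfl⟩ := Submodule.Quotient.mk_surjective _ u
  exact isHolomorphicOnPolydisc_coprod_incl x

end Couple

/-! ### `H^p` is contained in the interpolation space -/

theorem eLpNorm_rpow_le_one {α : Type*} [MeasurableSpace α] {μ : Measure α} {w : α → ℝ}
    (hw : ∀ t, 0 ≤ w t) {p : ℝ} (hp : 0 < p) (hw1 : eLpNorm w (ENNReal.ofReal p) μ ≤ 1)
    {q : ℝ} (hq : 0 < q) : eLpNorm (fun t => w t ^ (p / q)) (ENNReal.ofReal q) μ ≤ 1 := by
  have h := eLpNorm_norm_rpow (μ := μ) (p := ENNReal.ofReal q) w (q := p / q) (by positivity)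
  rw [← ENNReal.ofReal_mul hq.le, mul_div_cancel₀ _ hq.ne'] at h
  simp only [Real.norm_of_nonneg (hw _)] at h
  rw [h]
  exact ENNReal.rpow_le_one hw1 (by positivity)

section Forward

variable {n : ℕ}

/-- The exponent of the extremal family. -/
def interpExponent (p : ℝ) (z : ℂ) : ℂ := p * (1 / 2 - z / 4)

theorem interpExponent_re (p : ℝ) (z : ℂ) : (interpExponent p z).re = p * (1 / 2 - z.re / 4) := by
  simp [interpExponent, Complex.mul_re]

theorem differentiable_interpExponent (p : ℝ) : Differentiable ℂ (interpExponent p) := by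
  unfold interpExponent; fun_prop

/-- Over the strip the exponent of `w` has real part between `p/4` and `p/2`, and `w^{p/4}` lies in
`L⁴ ⊆ L²`. The whole family is thus `H²`-valued, and `H⁴` enters only on the line `Re z = 1`. -/
theorem exists_calderonFunction {p : ℝ} (hp : 0 < p) {σ : UnitAddTorus (Fin n) → ℂ}
    {w : UnitAddTorus (Fin n) → ℝ} (hσ : AEStronglyMeasurable σ (torusMeasure n))
    (hσ1 : ∀ t, ‖σ t‖ ≤ 1) (hw : AEMeasurable w (torusMeasure n)) (hw0 : ∀ t, 0 ≤ w t)
    (hw1 : eLpNorm w (ENNReal.ofReal p) (torusMeasure n) ≤ 1) {M : ℝ≥0} {θ : ℝ}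
    (hθ : θ ∈ Ioo (0 : ℝ) 1) (hpθ : p * (1 / 2 - θ / 4) = 1) :
    ∃ F : CalderonFunction (Hardy.incl n 2) (Hardy.incl n 4),
      F.value θ = (M : ℂ) • szegoProj (fun t => σ t * w t) ∧ F.size ≤ 2 ^ n * M := by
  have h2b := eLpNorm_rpow_le_one hw0 hp hw1 (q := 2) two_pos
  have h4a := eLpNorm_rpow_le_one hw0 hp hw1 (q := 4) four_pos
  rw [ENNReal.ofReal_ofNat] at h2b h4a
  have hmeas : ∀ s : ℝ, AEStronglyMeasurable (fun t => w t ^ s) (torusMeasure n) := fun s =>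
    (hw.pow_const s).aestronglyMeasurable
  have h2a : eLpNorm (fun t => w t ^ (p / 4)) 2 (torusMeasure n) ≤ 1 :=
    (eLpNorm_le_eLpNorm_of_exponent_le two_le_four_ennreal (hmeas _)).trans h4a
  have fam2 : PowerFamily (torusMeasure n) 2 σ w (p / 4) (p / 2) :=
    ⟨one_le_two, by simp, hσ, hσ1, hw, hw0, by positivity,
      ⟨hmeas _, h2a.trans_lt ENNReal.one_lt_top⟩, ⟨hmeas _, h2b.trans_lt ENNReal.one_lt_top⟩⟩
  -- Strips of zero width: `fam2'` and `fam4` describe the powers on the two boundary lines, where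
  -- the exponent has constant real part.
  have fam2' : PowerFamily (torusMeasure n) 2 σ w (p / 2) (p / 2) :=
    { fam2 with pos := by positivity, left := fam2.right }
  have fam4 : PowerFamily (torusMeasure n) 4 σ w (p / 4) (p / 4) :=
    ⟨by norm_num, by simp, hσ, hσ1, hw, hw0, by positivity,
      ⟨hmeas _, h4a.trans_lt ENNReal.one_lt_top⟩, ⟨hmeas _, h4a.trans_lt ENNReal.one_lt_top⟩⟩
  let P2 := (szegoBound_two n).toHardy (q := 2) (by simp)
  let P4 := (szegoBound_four n).toHardy (q := 4) (by simp)
  have hmaps : MapsTo (interpExponent p) (Complex.re ⁻¹' Icc 0 1)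
      (Complex.re ⁻¹' Icc (p / 4) (p / 2)) := by
    intro z hz
    rw [mem_preimage, interpExponent_re]
    constructor <;> nlinarith [hz.1, hz.2]
  have hmaps' : MapsTo (interpExponent p) (Complex.re ⁻¹' Ioo 0 1)
      (Complex.re ⁻¹' Ioo (p / 4) (p / 2)) := by
    intro z hz
    rw [mem_preimage, interpExponent_re]
    constructor <;> nlinarith [hz.1, hz.2]
  have hleft : ∀ t : ℝ, (interpExponent p (t * Complex.I)).re = p / 2 := fun t => by
    rw [interpExponent_re]; simp; ring
  have hright : ∀ t : ℝ, (interpExponent p (1 + t * Complex.I)).re = p / 4 := fun t => by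
    rw [interpExponent_re]; simp; ring
  have hnorm : ∀ {q : ℝ≥0∞} {s : ℂ} {c : ℝ}, s.re = c → 0 < c →
      eLpNorm (fun t => w t ^ c) q (torusMeasure n) ≤ 1 → ∀ h : MemLp (fun t => σ t * (w t : ℂ) ^ s)
        q (torusMeasure n), ‖powLp (torusMeasure n) q σ w s‖ ≤ 1 := by
    intro q s c hs hc hle h
    rw [powLp, dif_pos h, Lp.norm_toLp]
    refine ENNReal.toReal_le_of_le_ofReal zero_le_one ?_
    rw [ENNReal.ofReal_one]
    refine (le_trans (eLpNorm_mono_real fun t => ?_) hle)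
    rw [norm_mul, norm_cpow_eq_rpow_re (hw0 t) (hs ▸ hc), hs]
    exact mul_le_of_le_one_left (Real.rpow_nonneg (hw0 t) _) (hσ1 t)
  have hnl : ∀ t : ℝ, ‖powLp (torusMeasure n) 2 σ w (interpExponent p (t * Complex.I))‖ ≤ 1 :=
    fun t => hnorm (hleft t) (by positivity) h2b (fam2'.memLp (by simp [hleft t]))
  have hnr : ∀ t : ℝ, ‖powLp (torusMeasure n) 4 σ w (interpExponent p (1 + t * Complex.I))‖ ≤ 1 :=
    fun t => hnorm (hright t) (by positivity) h4a (fam4.memLp (by simp [hright t]))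
  let G : ℂ → Hardy n 2 := fun z =>
    (M : ℂ) • P2 (powLp (torusMeasure n) 2 σ w (interpExponent p z))
  let K : ℂ → Hardy n 4 := fun z =>
    (M : ℂ) • P4 (powLp (torusMeasure n) 4 σ w (interpExponent p z))
  have hG : ContinuousOn G (Complex.re ⁻¹' Icc 0 1) :=
    (P2.continuous.comp_continuousOn (fam2.continuousOn_powLp.comp
      (differentiable_interpExponent p).continuous.continuousOn hmaps)).const_smul (M : ℂ)
  have hGl : ∀ t : ℝ, ‖G (t * Complex.I)‖ ≤ M := fun t => by
    simp only [G]
    rw [norm_smul, Complex.norm_real, NNReal.norm_eq]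
    refine mul_le_of_le_one_right M.2 (((szegoBound_two n).norm_toHardy_le _ _).trans ?_)
    simpa using hnl t
  have hKr : ∀ t : ℝ, ‖K (1 + t * Complex.I)‖ ≤ 2 ^ n * M := fun t => by
    simp only [K]
    rw [norm_smul, Complex.norm_real, NNReal.norm_eq, mul_comm]
    refine mul_le_mul_of_nonneg_right (((szegoBound_four n).norm_toHardy_le _ _).trans ?_) M.2
    simpa using mul_le_of_le_one_right (by positivity : (0 : ℝ) ≤ 2 ^ n) (hnr t)
  -- The `L²` and `L⁴` versions of `σ w^s` agree almost everywhere, so their projections are the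
  -- same function.
  have hGK : ∀ t : ℝ, Hardy.incl n 2 (G (1 + t * Complex.I))
      = Hardy.incl n 4 (K (1 + t * Complex.I)) := by
    intro t
    simp only [G, K, map_smul, P2, P4, SzegoBound.incl_toHardy]
    congr 1
    refine szegoProj_congr_ae ?_
    have hs : (interpExponent p (1 + t * Complex.I)).re ∈ Icc (p / 4) (p / 2) :=
      hmaps (by simp)
    exact (fam2.coeFn_powLp hs).trans (fam4.coeFn_powLp (by simp [hright t])).symm
  refine ⟨{ toFun := fun z => hardyInl n (G z)
            left := BoundedContinuousFunction.ofNormedAddCommGroup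
              (fun t : ℝ => G (t * Complex.I)) ?_ M hGl
            right := BoundedContinuousFunction.ofNormedAddCommGroup
              (fun t : ℝ => K (1 + t * Complex.I)) ?_ (2 ^ n * M) hKr
            continuousOn' := (hardyInl n).continuous.comp_continuousOn hG
            differentiableOn' := ?_
            bounded' := ?_
            left_eq := fun t => rfl
            right_eq := fun t => inl_eq_inr (hGK t) }, ?_, ?_⟩
  · exact hG.comp_continuous (f := fun t : ℝ => (t * Complex.I : ℂ)) (by fun_prop)
      fun t => by simp
  · have hc : Continuous fun t : ℝ => (1 + t * Complex.I : ℂ) := by fun_prop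
    refine (P4.continuous.comp (fam4.continuousOn_powLp.comp_continuous
      ((differentiable_interpExponent p).continuous.comp hc) fun t => ?_)).const_smul (M : ℂ)
    simp [hright t]
  · refine (hardyInl n).differentiable.comp_differentiableOn (DifferentiableOn.const_smul (c := (M : ℂ))
      (f := fun z => P2 (powLp (torusMeasure n) 2 σ w (interpExponent p z))) ?_)
    exact P2.differentiable.comp_differentiableOn (fam2.differentiableOn_powLp.comp
      (differentiable_interpExponent p).differentiableOn hmaps')
  · refine ⟨‖hardyInl n‖ * (M * (‖P2‖ * (eLpNorm (fun t => w t ^ (p / 4) + w t ^ (p / 2)) 2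
      (torusMeasure n)).toReal)), fun z hz => ?_⟩
    refine (hardyInl n).le_opNorm_of_le ?_
    simp only [G]
    rw [norm_smul, Complex.norm_real, NNReal.norm_eq]
    exact mul_le_mul_of_nonneg_left (P2.le_opNorm_of_le (fam2.norm_powLp_le (hmaps hz))) M.2
  · refine (toAmbient_inl (G θ)).trans ?_
    simp only [G, map_smul, P2, SzegoBound.incl_toHardy]
    congr 1
    have hθ' : interpExponent p θ = 1 := by
      have h := congrArg (fun x : ℝ => (x : ℂ)) hpθ
      push_cast at h
      rw [interpExponent, h]
    refine szegoProj_congr_ae ((fam2.coeFn_powLp (hmaps ?_)).trans (.of_forall fun t => ?_))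
    · simpa using ⟨hθ.1.le, hθ.2.le⟩
    · simp only [hθ', Complex.cpow_one]
  · have h1 : (1 : ℝ) ≤ 2 ^ n := one_le_pow₀ one_le_two
    have h2 : ((2 ^ n * M : ℝ≥0∞)).toReal = 2 ^ n * M := by simp
    refine max_le ?_ ?_
    · rw [← ofReal_norm]
      refine ENNReal.ofReal_le_of_le_toReal ?_
      rw [h2]
      exact (BoundedContinuousFunction.norm_ofNormedAddCommGroup_le _ M.2 hGl).trans
        (le_mul_of_one_le_left M.2 h1)
    · rw [← ofReal_norm]
      refine ENNReal.ofReal_le_of_le_toReal ?_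
      rw [h2]
      exact BoundedContinuousFunction.norm_ofNormedAddCommGroup_le _ (by positivity) hKr

theorem exists_calderonFunction_of_mem_hardySpace {p : ℝ} {θ : ℝ} (hθ : θ ∈ Ioo (0 : ℝ) 1)
    (hp : 0 < p) (hpθ : p * (1 / 2 - θ / 4) = 1) {f : openPolydisc n → ℂ}
    (hf : f ∈ hardySpace n (ENNReal.ofReal p)) :
    ∃ F : CalderonFunction (Hardy.incl n 2) (Hardy.incl n 4),
      F.value θ = f ∧ F.size ≤ 2 ^ n * hardyNorm (ENNReal.ofReal p) f := by
  have hp2 : 2 ≤ p := by nlinarith [hθ.1, hθ.2]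
  have hp2' : (2 : ℝ≥0∞) ≤ ENNReal.ofReal p := by
    rw [← ENNReal.ofReal_ofNat]; exact ENNReal.ofReal_le_ofReal hp2
  have hp0 : ENNReal.ofReal p ≠ 0 := by simpa using hp
  obtain ⟨g, hg, rfl⟩ := exists_szegoProj_eq hp2' hf
  have hglt : eLpNorm g (ENNReal.ofReal p) (torusMeasure n) < ∞ := hg.trans_lt hf.2
  set M : ℝ≥0 := (eLpNorm g (ENNReal.ofReal p) (torusMeasure n)).toNNReal with hM
  have hM' : (M : ℝ≥0∞) = eLpNorm g (ENNReal.ofReal p) (torusMeasure n) :=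
    ENNReal.coe_toNNReal hglt.ne
  have hgm := (Lp.aestronglyMeasurable g).aemeasurable
  have hw1 : eLpNorm (fun t => ‖g t‖ / (M : ℝ)) (ENNReal.ofReal p) (torusMeasure n) ≤ 1 := by
    have h1 : (fun t => ‖g t‖ / (M : ℝ)) = (M : ℝ)⁻¹ • fun t => ‖g t‖ := by
      funext t; simp [div_eq_inv_mul]
    rw [h1, eLpNorm_const_smul, eLpNorm_norm, ← hM']
    rcases eq_or_ne M 0 with h0 | h0
    · simp [h0]
    · rw [enorm_inv (by simpa using h0), NNReal.enorm_eq,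
        ENNReal.inv_mul_cancel (by simpa using h0) ENNReal.coe_ne_top]
  -- Polar decomposition of `g`. Division by zero makes `σ` vanish where `g` does, and `w = 0` if `M
  -- = 0`; in that case `g = 0` almost everywhere and `M σ w = g` persists.
  obtain ⟨F, hF, hFs⟩ := exists_calderonFunction (σ := fun t => g t / (‖g t‖ : ℂ))
    (w := fun t => ‖g t‖ / (M : ℝ)) (M := M) hp
    (hgm.div (Complex.measurable_ofReal.comp_aemeasurable hgm.norm)).aestronglyMeasurable
    (fun t => by
      rw [norm_div, Complex.norm_real, norm_norm]
      exact div_self_le_one _)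
    (hgm.norm.div_const _) (fun t => by positivity) hw1 hθ hpθ
  refine ⟨F, ?_, hFs.trans (by rw [hM']; gcongr)⟩
  rw [hF, ← szegoProj_smul]
  refine szegoProj_congr_ae ?_
  have hz : ∀ᵐ t ∂torusMeasure n, M = 0 → g t = 0 := by
    rcases eq_or_ne M 0 with h0 | h0
    · rw [h0, ENNReal.coe_zero] at hM'
      have h1 := (eLpNorm_eq_zero_iff (Lp.aestronglyMeasurable g) hp0).1 hM'.symm
      exact h1.mono fun t ht _ => ht
    · exact .of_forall fun t h => absurd h h0
  filter_upwards [hz] with t ht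
  simp only [Pi.smul_apply, smul_eq_mul, Complex.ofReal_div]
  rcases eq_or_ne (g t) 0 with h0 | h0
  · simp [h0]
  · have h1 : ((M : ℝ) : ℂ) ≠ 0 := by
      intro h
      exact h0 (ht (by exact_mod_cast h))
    have h2 : (‖g t‖ : ℂ) ≠ 0 := by simpa using h0
    field_simp

end Forward

/-! ### The interpolation space is contained in `H^p` -/

theorem norm_integral_mul_le_of_eLpNorm_le {α : Type*} [MeasurableSpace α] {μ : Measure α} {q q' : ℝ}
    (hqq : q.HolderConjugate q') {a b : α → ℂ} (ha : AEStronglyMeasurable a μ)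
    (hb : AEStronglyMeasurable b μ) {S T : ℝ} (hS : 0 ≤ S) (hT : 0 ≤ T)
    (haS : eLpNorm a (ENNReal.ofReal q) μ ≤ ENNReal.ofReal S)
    (hbT : eLpNorm b (ENNReal.ofReal q') μ ≤ ENNReal.ofReal T) :
    ‖∫ t, a t * b t ∂μ‖ ≤ S * T := by
  have := hqq.ennrealOfReal
  have h1 : eLpNorm (a • b) 1 μ ≤ ENNReal.ofReal S * ENNReal.ofReal T :=
    (eLpNorm_smul_le_mul_eLpNorm (p := ENNReal.ofReal q) (q := ENNReal.ofReal q') hb ha).trans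
      (mul_le_mul' haS hbT)
  rw [← ENNReal.ofReal_mul hS, eLpNorm_one_eq_lintegral_enorm] at h1
  have h2 := (enorm_integral_le_lintegral_enorm (μ := μ) fun t => a t * b t).trans h1
  rw [← ofReal_norm] at h2
  exact (ENNReal.ofReal_le_ofReal_iff (mul_nonneg hS hT)).1 h2

section Backward

variable {n : ℕ}

theorem memLp_torusMeasure_of_continuous {E : Type*} [NormedAddCommGroup E]
    {F : UnitAddTorus (Fin n) → E} [SecondCountableTopologyEither (UnitAddTorus (Fin n)) E]
    (hF : Continuous F) (q : ℝ≥0∞) : MemLp F q (torusMeasure n) := by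
  obtain ⟨C, hC⟩ := isCompact_univ.exists_bound_of_continuousOn hF.continuousOn
  exact MemLp.of_bound hF.aestronglyMeasurable C (.of_forall fun t => hC t (mem_univ t))

/-- The exponent of the dual extremal family. -/
def dualExponent (p : ℝ) (z : ℂ) : ℂ := p * (1 / 2 + z / 4)

theorem dualExponent_re (p : ℝ) (z : ℂ) : (dualExponent p z).re = p * (1 / 2 + z.re / 4) := by
  simp [dualExponent, Complex.mul_re]

theorem differentiable_dualExponent (p : ℝ) : Differentiable ℂ (dualExponent p) := by
  unfold dualExponent; fun_prop

/-- The pairing `G` with the dual family has `G θ = A ^ p`. Its boundary values are bounded by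
Hölder with exponents `(2, 2)` and `(4, 4/3)`, and the three lines theorem yields `A ^ p ≤ S * A ^
(p - 1)`. -/
theorem eLpNorm_value_dilate_le {p θ : ℝ} (hp : 0 < p) (hθ : θ ∈ Ioo (0 : ℝ) 1)
    (hpθ : p * (1 / 2 - θ / 4) = 1) (F : CalderonFunction (Hardy.incl n 2) (Hardy.incl n 4))
    (r : Ico (0 : ℝ) 1) :
    (eLpNorm (fun t => F.value θ (dilatedTorusPoint r t)) (ENNReal.ofReal p)
      (torusMeasure n)).toReal ≤ max ‖F.left‖ ‖F.right‖ := by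
  set S := max ‖F.left‖ ‖F.right‖
  have hS : 0 ≤ S := (norm_nonneg _).trans (le_max_left _ _)
  set v : UnitAddTorus (Fin n) → ℂ := fun t => F.value θ (dilatedTorusPoint r t)
  have hv : Continuous v := (isHolomorphicOnPolydisc_toAmbient (F.toFun θ)).continuous_dilate r
  have hvp := memLp_torusMeasure_of_continuous hv (ENNReal.ofReal p)
  set A := (eLpNorm v (ENNReal.ofReal p) (torusMeasure n)).toReal
  have hA : 0 ≤ A := ENNReal.toReal_nonneg
  have hA' : eLpNorm v (ENNReal.ofReal p) (torusMeasure n) = ENNReal.ofReal A :=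
    (ENNReal.ofReal_toReal hvp.eLpNorm_lt_top.ne).symm
  have hAp : ∫ t, ‖v t‖ ^ p ∂torusMeasure n = A ^ p := by
    have h1 := hvp.eLpNorm_eq_integral_rpow_norm (by simpa using hp) ENNReal.ofReal_ne_top
    rw [ENNReal.toReal_ofReal hp.le] at h1
    have h0 : 0 ≤ ∫ t, ‖v t‖ ^ p ∂torusMeasure n := integral_nonneg fun t => by positivity
    have h2 : A = (∫ t, ‖v t‖ ^ p ∂torusMeasure n) ^ p⁻¹ := by
      rw [← ENNReal.toReal_ofReal (r := (∫ t, ‖v t‖ ^ p ∂torusMeasure n) ^ p⁻¹) (by positivity),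
        ← h1]
    rw [h2, Real.rpow_inv_rpow h0 hp.ne']
  rcases hA.eq_or_lt with hA0 | hA0
  · rw [← hA0]; exact hS
  let σ : UnitAddTorus (Fin n) → ℂ := fun t => conj (v t) / (‖v t‖ : ℂ)
  have hwc : ∀ x : ℝ, 0 ≤ x → Continuous fun t => ‖v t‖ ^ x := fun x hx =>
    hv.norm.rpow_const fun t => Or.inr hx
  have hσ1 : ∀ t, ‖σ t‖ ≤ 1 := fun t => by
    simp only [σ]
    rw [norm_div, Complex.norm_real, norm_norm, Complex.norm_conj]
    exact div_self_le_one _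
  have hvm : AEMeasurable v (torusMeasure n) := hv.measurable.aemeasurable
  -- Since `v` is continuous on a compact torus, all its nonnegative powers lie in `L²`. Holomorphy
  -- of `G` can thus be read off the `L²` pairing, `L^{4/3}` being needed only for the bound on `Re
  -- z = 1`.
  have fam : PowerFamily (torusMeasure n) 2 σ (fun t => ‖v t‖) (p / 2) (p * (3 / 4)) :=
    ⟨one_le_two, by simp, ((Complex.continuous_conj.measurable.comp_aemeasurable hvm).div
      (Complex.measurable_ofReal.comp_aemeasurable hvm.norm)).aestronglyMeasurable, hσ1,
      hvm.norm, fun t => norm_nonneg _, by positivity,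
      memLp_torusMeasure_of_continuous (hwc _ (by positivity)) 2,
      memLp_torusMeasure_of_continuous (hwc _ (by positivity)) 2⟩
  have hmaps : MapsTo (dualExponent p) (Complex.re ⁻¹' Icc 0 1)
      (Complex.re ⁻¹' Icc (p / 2) (p * (3 / 4))) := by
    intro z hz
    rw [mem_preimage, dualExponent_re]
    constructor <;> nlinarith [hz.1, hz.2]
  have hmaps' : MapsTo (dualExponent p) (Complex.re ⁻¹' Ioo 0 1)
      (Complex.re ⁻¹' Ioo (p / 2) (p * (3 / 4))) := by
    intro z hz
    rw [mem_preimage, dualExponent_re]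
    constructor <;> nlinarith [hz.1, hz.2]
  have hdual : ∀ (s : ℂ) (q : ℝ), 0 < q → s.re = p / q →
      eLpNorm (fun t => σ t * (‖v t‖ : ℂ) ^ s) (ENNReal.ofReal q) (torusMeasure n)
        ≤ ENNReal.ofReal (A ^ (p / q)) := by
    intro s q hq hs
    have h := eLpNorm_norm_rpow (μ := torusMeasure n) (p := ENNReal.ofReal q) v (q := p / q)
      (by positivity)
    rw [← ENNReal.ofReal_mul hq.le, mul_div_cancel₀ _ hq.ne', hA',
      ENNReal.ofReal_rpow_of_nonneg hA (by positivity)] at h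
    rw [← h]
    refine eLpNorm_mono_real fun t => ?_
    rw [norm_mul, norm_cpow_eq_rpow_re (norm_nonneg _) (by rw [hs]; positivity), hs]
    exact mul_le_of_le_one_left (by positivity) (hσ1 t)
  let B := (ContinuousLinearMap.mul ℂ ℂ).lpPairing (torusMeasure n) 2 2
  let φ : ℂ → Lp ℂ 2 (torusMeasure n) := fun z =>
    powLp (torusMeasure n) 2 σ (fun t => ‖v t‖) (dualExponent p z)
  let G : ℂ → ℂ := fun z => B (dilateSum n r (F.toFun z)) (φ z)
  have hφ : ∀ {z : ℂ}, z.re ∈ Icc (0 : ℝ) 1 →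
      φ z =ᵐ[torusMeasure n] fun t => σ t * (‖v t‖ : ℂ) ^ dualExponent p z := fun hz =>
    fam.coeFn_powLp (hmaps hz)
  have hGint : ∀ {z : ℂ}, z.re ∈ Icc (0 : ℝ) 1 → G z = ∫ t,
      CoupleSum.toAmbient (Hardy.incl n 2) (Hardy.incl n 4) (F.toFun z) (dilatedTorusPoint r t) *
        (σ t * (‖v t‖ : ℂ) ^ dualExponent p z) ∂torusMeasure n := by
    intro z hz
    refine (ContinuousLinearMap.lpPairing_eq_integral _ _ _).trans (integral_congr_ae ?_)
    filter_upwards [coeFn_dilateSum r (F.toFun z), hφ hz] with t h1 h2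
    rw [h1, h2]
    rfl
  have hGc : ContinuousOn G (Complex.re ⁻¹' Icc 0 1) := by
    refine ContinuousOn.clm_apply ?_ ?_
    · exact B.continuous.comp_continuousOn ((dilateSum n r).continuous.comp_continuousOn
        F.continuousOn')
    · exact fam.continuousOn_powLp.comp (differentiable_dualExponent p).continuous.continuousOn hmaps
  have hGd : DifferentiableOn ℂ G (Complex.re ⁻¹' Ioo 0 1) := by
    refine DifferentiableOn.clm_apply ?_ ?_
    · exact B.differentiable.comp_differentiableOn
        ((dilateSum n r).differentiable.comp_differentiableOn F.differentiableOn')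
    · exact fam.differentiableOn_powLp.comp (differentiable_dualExponent p).differentiableOn hmaps'
  have hdc : DiffContOnCl ℂ G (Complex.HadamardThreeLines.verticalStrip 0 1) := by
    refine ⟨hGd, hGc.mono ?_⟩
    refine closure_minimal (preimage_mono Ioo_subset_Icc_self)
      (isClosed_Icc.preimage Complex.continuous_re)
  have hbdd : BddAbove ((norm ∘ G) '' Complex.HadamardThreeLines.verticalClosedStrip 0 1) := by
    obtain ⟨M, hM⟩ := F.bounded'
    refine ⟨‖B‖ * (‖dilateSum n r‖ * M) * (eLpNorm (fun t => ‖v t‖ ^ (p / 2) +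
      ‖v t‖ ^ (p * (3 / 4))) 2 (torusMeasure n)).toReal, ?_⟩
    rintro _ ⟨z, hz, rfl⟩
    exact ContinuousLinearMap.le_of_opNorm_le_of_le _ (B.le_opNorm_of_le
      ((dilateSum n r).le_opNorm_of_le (hM z hz))) (fam.norm_powLp_le (hmaps hz))
  have hleft : ∀ z ∈ Complex.re ⁻¹' {(0 : ℝ)}, ‖G z‖ ≤ S * A ^ (p / 2) := by
    intro z hz
    have hz0 : z.re = 0 := hz
    obtain ⟨y, rfl⟩ : ∃ y : ℝ, z = y * Complex.I := ⟨z.im, by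
      apply Complex.ext <;> simp [hz0]⟩
    rw [hGint (by simp [hz0]), F.left_eq, toAmbient_inl]
    refine norm_integral_mul_le_of_eLpNorm_le Real.HolderConjugate.two_two
      ((Hardy.incl_mem (F.left y)).1.aestronglyMeasurable r) (fam.aestronglyMeasurable_cpow _) hS
      (by positivity) ?_ (hdual _ 2 two_pos ?_)
    · rw [ENNReal.ofReal_ofNat]
      refine (eLpNorm_dilate_le_hardyNorm 2 _ r).trans ?_
      refine (ENNReal.le_ofReal_iff_toReal_le (Hardy.incl_mem (F.left y)).2.ne hS).2 ?_
      exact (F.left.norm_coe_le_norm y).trans (le_max_left _ _)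
    · rw [dualExponent_re, hz0]; ring
  have hright : ∀ z ∈ Complex.re ⁻¹' {(1 : ℝ)}, ‖G z‖ ≤ S * A ^ (p / (4 / 3)) := by
    intro z hz
    have hz0 : z.re = 1 := hz
    obtain ⟨y, rfl⟩ : ∃ y : ℝ, z = 1 + y * Complex.I := ⟨z.im, by
      apply Complex.ext <;> simp [hz0]⟩
    rw [hGint (by simp [hz0]), F.right_eq, toAmbient_inr]
    refine norm_integral_mul_le_of_eLpNorm_le (q := 4) (q' := 4 / 3)
      (Real.holderConjugate_iff.2 ⟨by norm_num, by norm_num⟩)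
      ((Hardy.incl_mem (F.right y)).1.aestronglyMeasurable r) (fam.aestronglyMeasurable_cpow _) hS
      (by positivity) ?_ (hdual _ (4 / 3) (by norm_num) ?_)
    · rw [ENNReal.ofReal_ofNat]
      refine (eLpNorm_dilate_le_hardyNorm 4 _ r).trans ?_
      refine (ENNReal.le_ofReal_iff_toReal_le (Hardy.incl_mem (F.right y)).2.ne hS).2 ?_
      exact (F.right.norm_coe_le_norm y).trans (le_max_right _ _)
    · rw [dualExponent_re, hz0]; ring
  have hθ' : ((θ : ℂ)).re ∈ Icc (0 : ℝ) 1 := ⟨hθ.1.le, hθ.2.le⟩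
  have h3 := Complex.HadamardThreeLines.norm_le_interp_of_mem_verticalClosedStrip₀₁' G hθ' hdc hbdd
    hleft hright
  -- The dual exponent is `p (1 - 1/p(z))`, which is `p - 1` at `θ`. The powers of `A` from the two
  -- boundary bounds combine to the same exponent.
  have hpθ' : p * (1 / 2 + θ / 4) = p - 1 := by linarith
  have hGθ : G θ = ((A ^ p : ℝ) : ℂ) := by
    have hs : dualExponent p θ = ((p - 1 : ℝ) : ℂ) := by
      rw [dualExponent, ← hpθ']; push_cast; ring
    rw [hGint hθ', ← hAp, ← integral_complex_ofReal]
    refine integral_congr_ae (.of_forall fun t => ?_)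
    change v t * (σ t * (‖v t‖ : ℂ) ^ dualExponent p θ) = ((‖v t‖ ^ p : ℝ) : ℂ)
    rcases eq_or_ne (v t) 0 with h0 | h0
    · simp [h0, hp.ne']
    · have hn : 0 < ‖v t‖ := norm_pos_iff.2 h0
      have hn' : (‖v t‖ : ℂ) ≠ 0 := by exact_mod_cast hn.ne'
      rw [hs, ← Complex.ofReal_cpow hn.le, Real.rpow_sub_one hn.ne']
      simp only [σ]
      have h1 : v t * conj (v t) = (‖v t‖ : ℂ) ^ 2 := Complex.mul_conj' (v t)
      push_cast
      calc _ = v t * conj (v t) * ((‖v t‖ ^ p : ℝ) : ℂ) / (‖v t‖ : ℂ) ^ 2 := by field_simp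
        _ = _ := by rw [h1]; field_simp
  rw [hGθ, Complex.norm_real, Real.norm_of_nonneg (by positivity), Complex.ofReal_re,
    Real.mul_rpow hS (by positivity), Real.mul_rpow hS (by positivity), ← Real.rpow_mul hA,
    ← Real.rpow_mul hA] at h3
  have h4 : S ^ (1 - θ) * A ^ (p / 2 * (1 - θ)) * (S ^ θ * A ^ (p / (4 / 3) * θ))
      = S * A ^ (p - 1) := by
    have hS1 : S ^ (1 - θ) * S ^ θ = S := by
      rw [← Real.rpow_add_of_nonneg hS (by linarith [hθ.2]) hθ.1.le]
      simp
    have hA1 : A ^ (p / 2 * (1 - θ)) * A ^ (p / (4 / 3) * θ) = A ^ (p - 1) := by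
      rw [← Real.rpow_add hA0, ← hpθ']
      congr 1; ring
    rw [← hA1]
    calc _ = (S ^ (1 - θ) * S ^ θ) * (A ^ (p / 2 * (1 - θ)) * A ^ (p / (4 / 3) * θ)) := by ring
      _ = _ := by rw [hS1]
  rw [h4] at h3
  have h5 : A ^ p = A * A ^ (p - 1) := by
    rw [Real.rpow_sub_one hA0.ne']; field_simp
  rw [h5] at h3
  exact le_of_mul_le_mul_right h3 (by positivity)

theorem hardyNorm_value_le {p θ : ℝ} (hp : 0 < p) (hθ : θ ∈ Ioo (0 : ℝ) 1)
    (hpθ : p * (1 / 2 - θ / 4) = 1) (F : CalderonFunction (Hardy.incl n 2) (Hardy.incl n 4)) :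
    hardyNorm (ENNReal.ofReal p) (F.value θ) ≤ F.size := by
  refine iSup_le fun r => ?_
  have hv : MemLp (fun t => F.value θ (dilatedTorusPoint r t)) (ENNReal.ofReal p) (torusMeasure n) :=
    (isHolomorphicOnPolydisc_toAmbient (F.toFun θ)).memLp_dilate r (ENNReal.ofReal p)
  have h := eLpNorm_value_dilate_le hp hθ hpθ F r
  rw [← ENNReal.le_ofReal_iff_toReal_le hv.eLpNorm_lt_top.ne (le_max_of_le_left (norm_nonneg _))]
    at h
  rwa [ENNReal.ofReal_max, ofReal_norm, ofReal_norm] at h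

end Backward

/-- The complex interpolation space of `H²(𝔻ⁿ)` and `H⁴(𝔻ⁿ)` at `θ` is `H^p(𝔻ⁿ)`, with equivalent
norms, the constant depending on the dimension only. -/
theorem mainTheorem6 (n : ℕ) :
    ∃ C : ℝ≥0, ∀ θ ∈ Ioo (0 : ℝ) 1, ∀ p : ℝ, 1 / p = (1 - θ) / 2 + θ / 4 →
      complexInterpolation (Hardy.incl n 2) (Hardy.incl n 4) θ =
          (hardySpace n (ENNReal.ofReal p) : Set (openPolydisc n → ℂ)) ∧
        ∀ f ∈ hardySpace n (ENNReal.ofReal p),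
          complexInterpolationNorm (Hardy.incl n 2) (Hardy.incl n 4) θ f ≤
              C * hardyNorm (ENNReal.ofReal p) f ∧
            hardyNorm (ENNReal.ofReal p) f ≤
              C * complexInterpolationNorm (Hardy.incl n 2) (Hardy.incl n 4) θ f := by
  -- The constant is the `L⁴` bound of the Szegő projection, independent of `θ`; the reverse
  -- inequality already holds with constant `1`.
  refine ⟨2 ^ n, fun θ hθ p hpθ => ?_⟩
  have hinv : 1 / p = 1 / 2 - θ / 4 := by linarith
  have hp : 0 < p := by
    rw [← one_div_pos, hinv]; linarith [hθ.2]
  have hpθ' : p * (1 / 2 - θ / 4) = 1 := by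
    rw [← hinv, mul_one_div_cancel hp.ne']
  have hC : ((2 ^ n : ℝ≥0) : ℝ≥0∞) = 2 ^ n := by simp
  rw [hC]
  refine ⟨Set.ext fun f => ⟨?_, fun hf => ?_⟩, fun f hf => ⟨?_, ?_⟩⟩
  · rintro ⟨F, rfl⟩
    refine ⟨isHolomorphicOnPolydisc_toAmbient _, (hardyNorm_value_le hp hθ hpθ' F).trans_lt ?_⟩
    exact max_lt enorm_lt_top enorm_lt_top
  · obtain ⟨F, hF, -⟩ := exists_calderonFunction_of_mem_hardySpace hθ hp hpθ' hf
    exact ⟨F, hF⟩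
  · obtain ⟨F, hF, hFs⟩ := exists_calderonFunction_of_mem_hardySpace hθ hp hpθ' hf
    exact (iInf₂_le F hF).trans hFs
  · refine le_trans (le_iInf₂ fun F hF => ?_) (le_mul_of_one_le_left bot_le (one_le_pow₀ one_le_two))
    rw [← hF]
    exact hardyNorm_value_le hp hθ hpθ' F

end
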